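/- Fix an agent intensity $\lambda>0$, a maximum communication range $R_{\max}>0$, a noise level $\sigma>0$ and a number $N\ge 1$ of two-way timing rounds. For each number of agents $n$ let $\mathcal R_n\subset\mathbb R^2$ be a measurable region of area $n/\lambda$ (an extended network: the intensity $\lambda$ does not depend on $n$), and assume that the regions expand in both dimensions, i.e. there is $\delta>0$ such that for all sufficiently large $n$ the region $\mathcal R_n$ contains a disk of radius $\delta\sqrt n$ (for example, squares, or rescaled copies of a fixed bounded shape with non-empty interior). The $n$ agents form a binomial point process on $\mathcal R_n$, i.e. their positions are independent and uniformly distributed on $\mathcal R_n$; two distinct agents are neighbours iff their Euclidean distance is at most $R_{\max}$, and the network is assumed to be connected, i.e. the binomial point process is conditioned on this graph being connected. Let $\mathbf A$ be the adjacency matrix of the graph, $\mathbf D$ the diagonal matrix of the numbers of neighbours, $\mathbf J=\frac{2N}{\sigma^2}(\mathbf D-\mathbf A)$ the Fisher information matrix of the clock offsets in relative synchronization, and $\bar s=\frac1n\operatorname{tr}\mathbf J^{\dagger}$ the relative synchronization error bound, where $\dagger$ denotes the Moore-Penrose pseudo-inverse. Then $$\mathbb E\big[\,\bar s\,\big|\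 \text{the network is connected}\,\big]\longrightarrow\infty\qquad\text{as } n\to\infty .$$ -/

import Mathlib

open MeasureTheory ProbabilityTheory Filter Topology
open scoped Matrix

namespace NetSync

/-- The plane with its Euclidean distance. -/
abbrev Plane : Type := EuclideanSpace ℝ (Fin 2)

section PseudoInverse

variable {n : ℕ}

/-- The four Penrose equations: `B` is the Moore-Penrose pseudo-inverse of the real matrix `A`. -/
structure IsMoorePenrose (A B : Matrix (Fin n) (Fin n) ℝ) : Prop where
  mul_mul_left : A * B * A = A
  mul_mul_right : B * A * B = B
  left_symm : (A * B)ᵀ = A * B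
  right_symm : (B * A)ᵀ = B * A

/-- The pseudo-inverse is unique. -/
theorem IsMoorePenrose.unique {A B C : Matrix (Fin n) (Fin n) ℝ}
    (hB : IsMoorePenrose A B) (hC : IsMoorePenrose A C) : B = C := by
  have h1 : A * B = A * C := by
    calc A * B = (A * B)ᵀ := hB.left_symm.symm
      _ = ((A * C) * (A * B))ᵀ := by rw [← Matrix.mul_assoc, hC.mul_mul_left]
      _ = (A * B) * (A * C) := by rw [Matrix.transpose_mul, hB.left_symm, hC.left_symm]
      _ = A * C := by rw [← Matrix.mul_assoc, hB.mul_mul_left]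
  have h2 : B * A = C * A := by
    calc B * A = (B * A)ᵀ := hB.right_symm.symm
      _ = ((B * A) * (C * A))ᵀ := by
          rw [Matrix.mul_assoc, ← Matrix.mul_assoc A, hC.mul_mul_left]
      _ = (C * A) * (B * A) := by rw [Matrix.transpose_mul, hB.right_symm, hC.right_symm]
      _ = C * A := by rw [Matrix.mul_assoc, ← Matrix.mul_assoc A, hB.mul_mul_left]
  calc B = B * A * B := hB.mul_mul_right.symm
    _ = C * (A * B) := by rw [h2, Matrix.mul_assoc]
    _ = C * A * C := by rw [h1, Matrix.mul_assoc]
    _ = C := hC.mul_mul_right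

/-- The transpose of the pseudo-inverse is the pseudo-inverse of the transpose. -/
theorem IsMoorePenrose.transpose {A B : Matrix (Fin n) (Fin n) ℝ}
    (h : IsMoorePenrose A B) : IsMoorePenrose Aᵀ Bᵀ where
  mul_mul_left := by
    rw [← Matrix.transpose_mul, ← Matrix.transpose_mul, ← Matrix.mul_assoc, h.mul_mul_left]
  mul_mul_right := by
    rw [← Matrix.transpose_mul, ← Matrix.transpose_mul, ← Matrix.mul_assoc, h.mul_mul_right]
  left_symm := by rw [← Matrix.transpose_mul, h.right_symm, h.right_symm]
  right_symm := by rw [← Matrix.transpose_mul, h.left_symm, h.left_symm]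

/-- A real symmetric matrix has a pseudo-inverse: invert its nonzero eigenvalues. -/
theorem exists_isMoorePenrose_of_isHermitian {A : Matrix (Fin n) (Fin n) ℝ}
    (hA : A.IsHermitian) : ∃ B, IsMoorePenrose A B := by
  obtain ⟨U, V, d, hVU, hUt, hAd⟩ : ∃ (U V : Matrix (Fin n) (Fin n) ℝ) (d : Fin n → ℝ),
      V * U = 1 ∧ Vᵀ = U ∧ A = U * Matrix.diagonal d * V := by
    refine ⟨hA.eigenvectorUnitary, star (hA.eigenvectorUnitary : Matrix (Fin n) (Fin n) ℝ),
      hA.eigenvalues, ?_, ?_, ?_⟩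
    · exact Unitary.coe_star_mul_self _
    · rw [Matrix.star_eq_conjTranspose, Matrix.conjTranspose_eq_transpose_of_trivial,
        Matrix.transpose_transpose]
    · simpa [Unitary.conjStarAlgAut_apply] using hA.spectral_theorem
  have hVt : Uᵀ = V := by rw [← hUt, Matrix.transpose_transpose]
  have key : ∀ a b : Fin n → ℝ, (U * Matrix.diagonal a * V) * (U * Matrix.diagonal b * V)
      = U * Matrix.diagonal (fun i => a i * b i) * V := by
    intro a b
    calc (U * Matrix.diagonal a * V) * (U * Matrix.diagonal b * V)
        = U * Matrix.diagonal a * (V * U) * Matrix.diagonal b * V := by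
          simp only [Matrix.mul_assoc]
      _ = _ := by
          rw [hVU, Matrix.mul_one, Matrix.mul_assoc U, Matrix.diagonal_mul_diagonal]
  have keyt : ∀ a : Fin n → ℝ, (U * Matrix.diagonal a * V)ᵀ = U * Matrix.diagonal a * V := by
    intro a
    rw [Matrix.transpose_mul, Matrix.transpose_mul, Matrix.diagonal_transpose, hUt, hVt,
      Matrix.mul_assoc]
  refine ⟨U * Matrix.diagonal (fun i => (d i)⁻¹) * V, ?_, ?_, ?_, ?_⟩ <;>
    simp only [hAd, key, keyt]
  all_goals
    congr 3
    funext i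
    by_cases h : d i = 0 <;> simp [h]

/-- Every real square matrix has a pseudo-inverse. -/
theorem exists_isMoorePenrose (A : Matrix (Fin n) (Fin n) ℝ) : ∃ B, IsMoorePenrose A B := by
  have hG : (Aᵀ * A)ᵀ = Aᵀ * A := by rw [Matrix.transpose_mul, Matrix.transpose_transpose]
  obtain ⟨G, h⟩ := exists_isMoorePenrose_of_isHermitian (A := Aᵀ * A)
    (by rw [Matrix.IsHermitian, Matrix.conjTranspose_eq_transpose_of_trivial, hG])
  have hGs : Gᵀ = G := by
    have h' := h.transpose
    rw [hG] at h'
    exact h'.unique h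
  have hz : A * (1 - G * (Aᵀ * A)) = 0 := by
    rw [← Matrix.conjTranspose_mul_self_eq_zero, Matrix.conjTranspose_eq_transpose_of_trivial,
      Matrix.transpose_mul, Matrix.mul_assoc, ← Matrix.mul_assoc Aᵀ, Matrix.mul_sub,
      Matrix.mul_one, ← Matrix.mul_assoc (Aᵀ * A) G, h.mul_mul_left, sub_self, Matrix.mul_zero]
  have hA : A * G * Aᵀ * A = A := by
    rw [Matrix.mul_sub, Matrix.mul_one, sub_eq_zero] at hz
    simpa only [Matrix.mul_assoc] using hz.symm
  refine ⟨G * Aᵀ, ?_, ?_, ?_, ?_⟩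
  · rw [← Matrix.mul_assoc, hA]
  · have := h.mul_mul_right
    calc G * Aᵀ * A * (G * Aᵀ) = (G * (Aᵀ * A) * G) * Aᵀ := by simp only [Matrix.mul_assoc]
      _ = G * Aᵀ := by rw [this]
  · rw [Matrix.transpose_mul, Matrix.transpose_mul, Matrix.transpose_transpose, hGs,
      Matrix.mul_assoc]
  · rw [Matrix.mul_assoc]
    exact h.right_symm

/-- The Moore-Penrose pseudo-inverse of a real square matrix. -/
noncomputable def pinv (A : Matrix (Fin n) (Fin n) ℝ) : Matrix (Fin n) (Fin n) ℝ :=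
  (exists_isMoorePenrose A).choose

theorem pinv_spec (A : Matrix (Fin n) (Fin n) ℝ) : IsMoorePenrose A (pinv A) :=
  (exists_isMoorePenrose A).choose_spec

end PseudoInverse

/-- The communication graph of agents at positions `p`: two distinct agents are neighbours iff
their Euclidean distance is at most the maximum communication range `Rmax`. -/
def commGraph (Rmax : ℝ) {n : ℕ} (p : Fin n → Plane) : SimpleGraph (Fin n) where
  Adj i j := i ≠ j ∧ dist (p i) (p j) ≤ Rmax
  symm := ⟨fun i j h => ⟨h.1.symm, by rw [dist_comm]; exact h.2⟩⟩
  loopless := ⟨fun _ h => h.1 rfl⟩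

open Classical in
/-- The Fisher information matrix `(2N/σ²)(D - A)` of the clock offsets in relative
synchronization, after `rounds = N` rounds of two-way timing with noise variance `σ²`. Here `D`
is the diagonal matrix of the numbers of neighbours, `A` the adjacency matrix. -/
noncomputable def fim (rounds : ℕ) (σ Rmax : ℝ) {n : ℕ} (p : Fin n → Plane) :
    Matrix (Fin n) (Fin n) ℝ :=
  (2 * (rounds : ℝ) / σ ^ 2) •
    ((commGraph Rmax p).degMatrix ℝ - (commGraph Rmax p).adjMatrix ℝ)

/-- The relative synchronization error bound, `(1/n) tr J†` with `J` the Fisher information. -/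
noncomputable def rseb (rounds : ℕ) (σ Rmax : ℝ) {n : ℕ} (p : Fin n → Plane) : ℝ :=
  (n : ℝ)⁻¹ * (pinv (fim rounds σ Rmax p)).trace

/-- The binomial point process of `n` agents on the region `S`, as the law of the vector of
positions: independent positions, each uniformly distributed on `S`. -/
noncomputable def binomialLaw (S : Set Plane) (n : ℕ) : Measure (Fin n → Plane) :=
  Measure.pi fun _ => cond volume S

/-- The law of a connected random network: the binomial point process conditioned on the
communication graph being connected. -/
noncomputable def connectedLaw (Rmax : ℝ) (S : Set Plane) (n : ℕ) : Measure (Fin n → Plane) :=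
  cond (binomialLaw S n) {p | (commGraph Rmax p).Connected}

/-- The regions of an extended network: the region of the network with `n` agents has area
`n / lam`, so that the intensity of agents is `lam` for every `n`, and it expands in all
directions, in that (for large `n`) it contains a disk of radius proportional to `√n`. -/
structure IsExtended (lam : ℝ) (region : ℕ → Set Plane) : Prop where
  measurableSet : ∀ n, MeasurableSet (region n)
  area : ∀ n, volume (region n) = ENNReal.ofReal (n / lam)
  disk : ∃ δ : ℝ, 0 < δ ∧ ∀ᶠ n : ℕ in atTop, ∃ x, Metric.ball x (δ * √(n : ℝ)) ⊆ region n

end NetSync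

/-! The Fisher matrix `J` is a multiple of the graph Laplacian, and planar effective resistances
grow logarithmically with distance. Accordingly the conditional mean of the error bound is shown to
be at least of order `log n`.

Deterministic part. Nonnegativity of the energy of `J† e_i - t f` turns every test function `f` into
a lower bound for `(J†)_ii` (`pinv_diag_ge`). Take for `f` minus the logarithm of the distance to
agent `i`. Across a link it changes by about the inverse distance, and inverse squares sum to `log
n` in the plane; its value at `i` exceeds its mean by order `log n`, on average over `i`, because
most pairs are far apart. A constant `t` balances gain and cost (`rseb_ge_log`). This needs only
that the squared cell occupancies seen by the agents sum to `O(n)`.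

Probabilistic part. Connectivity may be exponentially unlikely, so concentration for the
unconditioned process is of no use. Instead, all but 49 agents of a cell are redundant: any single
one can be deleted without disconnecting the network. A redundant agent shares the cell of another
agent, which given the others costs a factor `O(1/n)` per candidate. Hence a crowding moment for `k
+ 1` agents is bounded through a lower moment for `k` agents (`lintegral_sum_cellCount_pow_le`), and
two deletions suffice.

Each deletion costs the ratio of the connectivity probabilities for `k` and `k + 1` agents. A new
agent joins with probability the coverage of the network. Coverage at most `s²` together with
connectivity has probability at most `(2s)^k`, since at most half of the agents dominate the others
(`measure_connected_small_coverage_le`), whereas filling a grid of disks gives connectivity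
probability at least `c^k` (`exists_pow_le_measure_connectedSet`). With `s = c/4` the ratio is
bounded, and Markov's inequality finishes the proof. -/

namespace NetSync

/-! ### Laplacians and the variational bound for the pseudo-inverse -/

/-- The pseudo-inverse of a symmetric matrix is symmetric. -/
theorem pinv_transpose {n : ℕ} {J : Matrix (Fin n) (Fin n) ℝ} (hJ : Jᵀ = J) :
    (pinv J)ᵀ = pinv J := by
  have h := (pinv_spec J).transpose
  rw [hJ] at h
  exact h.unique (pinv_spec J)

/-- A symmetric matrix commutes with its pseudo-inverse. -/
theorem mul_pinv_comm {n : ℕ} {J : Matrix (Fin n) (Fin n) ℝ} (hJ : Jᵀ = J) :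
    J * pinv J = pinv J * J := by
  rw [← (pinv_spec J).left_symm, Matrix.transpose_mul, pinv_transpose hJ, hJ]

/-- If the kernel of a symmetric matrix consists of the constant vectors, then the pseudo-inverse
inverts it up to subtraction of the mean. -/
theorem pinv_mul_mulVec {n : ℕ} {J : Matrix (Fin n) (Fin n) ℝ} (hJ : Jᵀ = J)
    (hker : ∀ v, J *ᵥ v = 0 → ∀ i j, v i = v j) (hone : J *ᵥ (fun _ => 1) = 0)
    (f : Fin n → ℝ) (i : Fin n) :
    ((pinv J * J) *ᵥ f) i = f i - (∑ j, f j) / n := by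
  -- `f - J†J f` lies in the kernel, hence is constant; as `J†J f` has mean zero, the constant is
  -- the mean of `f`.
  have hw : J *ᵥ (f - (pinv J * J) *ᵥ f) = 0 := by
    rw [Matrix.mulVec_sub, Matrix.mulVec_mulVec, ← Matrix.mul_assoc,
      (pinv_spec J).mul_mul_left, sub_self]
  have hc := hker _ hw
  have hsum : ∑ j, ((pinv J * J) *ᵥ f) j = 0 := by
    have h1 : ∑ j, ((pinv J * J) *ᵥ f) j = (fun _ => (1 : ℝ)) ⬝ᵥ ((pinv J * J) *ᵥ f) := by
      simp [dotProduct]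
    rw [h1, ← mul_pinv_comm hJ, ← Matrix.mulVec_mulVec, Matrix.dotProduct_mulVec,
      ← Matrix.mulVec_transpose, hJ, hone, zero_dotProduct]
  have hn : (n : ℝ) ≠ 0 := by
    have := i.pos
    positivity
  have h2 : ∑ j, (f - (pinv J * J) *ᵥ f) j = n * (f - (pinv J * J) *ᵥ f) i := by
    rw [Finset.sum_congr rfl fun j _ => hc j i, Finset.sum_const, Finset.card_univ,
      Fintype.card_fin, nsmul_eq_mul]
  simp only [Pi.sub_apply, Finset.sum_sub_distrib, hsum, sub_zero] at h2
  rw [h2, mul_div_cancel_left₀ _ hn, sub_sub_cancel]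

/-- Thomson's principle in dual form: every test function bounds the diagonal entries of the
pseudo-inverse of a Laplacian-like matrix from below. -/
theorem pinv_diag_ge {n : ℕ} {J : Matrix (Fin n) (Fin n) ℝ} (hpos : J.PosSemidef)
    (hker : ∀ v, J *ᵥ v = 0 → ∀ i j, v i = v j) (hone : J *ᵥ (fun _ => 1) = 0)
    (f : Fin n → ℝ) (t : ℝ) (i : Fin n) :
    2 * t * (f i - (∑ j, f j) / n) - t ^ 2 * (f ⬝ᵥ J *ᵥ f) ≤ pinv J i i := by
  have hJ : Jᵀ = J := by
    rw [← Matrix.conjTranspose_eq_transpose_of_trivial]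
    exact hpos.isHermitian
  set x : Fin n → ℝ := pinv J *ᵥ Pi.single i 1 with hx
  have hsymm : ∀ u v : Fin n → ℝ, u ⬝ᵥ J *ᵥ v = v ⬝ᵥ J *ᵥ u := by
    intro u v
    rw [Matrix.dotProduct_mulVec, ← Matrix.mulVec_transpose, hJ, dotProduct_comm]
  have hB : ∀ v : Fin n → ℝ, x ⬝ᵥ v = (pinv J *ᵥ v) i := by
    intro v
    rw [hx, ← pinv_transpose hJ, Matrix.mulVec_transpose, ← Matrix.dotProduct_mulVec,
      single_one_dotProduct, pinv_transpose hJ]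
  have hxf : x ⬝ᵥ J *ᵥ f = f i - (∑ j, f j) / n := by
    rw [hB, Matrix.mulVec_mulVec, pinv_mul_mulVec hJ hker hone]
  have hxx : x ⬝ᵥ J *ᵥ x = pinv J i i := by
    rw [hB, Matrix.mulVec_mulVec, hx, Matrix.mulVec_mulVec, (pinv_spec J).mul_mul_right]
    simp
  -- With `x = J† e_i`, the energy of `x` is the diagonal entry itself, and pairing `x` with `f`
  -- gives the deviation of `f i` from the mean.
  have h0 := hpos.dotProduct_mulVec_nonneg (x - t • f)
  simp only [star_trivial, Matrix.mulVec_sub, Matrix.mulVec_smul, sub_dotProduct,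
    dotProduct_sub, smul_dotProduct, dotProduct_smul, smul_eq_mul, hxx, hsymm f x, hxf] at h0
  nlinarith [h0]

open Classical in
theorem fim_eq (rounds : ℕ) (σ Rmax : ℝ) {n : ℕ} (p : Fin n → Plane) :
    fim rounds σ Rmax p = (2 * (rounds : ℝ) / σ ^ 2) • (commGraph Rmax p).lapMatrix ℝ := rfl

open Classical in
theorem fim_posSemidef (rounds : ℕ) (σ Rmax : ℝ) {n : ℕ} (p : Fin n → Plane) :
    (fim rounds σ Rmax p).PosSemidef := by
  rw [fim_eq]
  exact ((commGraph Rmax p).posSemidef_lapMatrix ℝ).smul (by positivity)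

open Classical in
/-- Test functions, one for each agent, bound the relative synchronization error bound of a
connected network from below. -/
theorem rseb_ge {rounds : ℕ} {σ : ℝ} (hr : 0 < rounds) (hσ : 0 < σ) (Rmax : ℝ) {n : ℕ}
    {p : Fin n → Plane} (hp : (commGraph Rmax p).Connected) (F : Fin n → Fin n → ℝ) (t : ℝ) :
    (n : ℝ)⁻¹ * ∑ i, (2 * t * (F i i - (∑ j, F i j) / n) - t ^ 2 * (2 * (rounds : ℝ) / σ ^ 2 *
      ((∑ a, ∑ b, if (commGraph Rmax p).Adj a b then (F i a - F i b) ^ 2 else 0) / 2)))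
      ≤ rseb rounds σ Rmax p := by
  have hκ : 0 < 2 * (rounds : ℝ) / σ ^ 2 := by positivity
  unfold rseb
  refine mul_le_mul_of_nonneg_left ?_ (by positivity)
  rw [Matrix.trace]
  refine Finset.sum_le_sum fun i _ => ?_
  have hker : ∀ v, fim rounds σ Rmax p *ᵥ v = 0 → ∀ i j, v i = v j := by
    intro v hv i j
    rw [fim_eq, Matrix.smul_mulVec, smul_eq_zero, or_iff_right hκ.ne',
      SimpleGraph.lapMatrix_mulVec_eq_zero_iff_forall_reachable] at hv
    exact hv i j (hp.preconnected i j)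
  have hone : fim rounds σ Rmax p *ᵥ (fun _ => 1) = 0 := by
    rw [fim_eq, Matrix.smul_mulVec, SimpleGraph.lapMatrix_mulVec_const_eq_zero, smul_zero]
  have h := pinv_diag_ge (fim_posSemidef rounds σ Rmax p) hker hone (F i) t i
  have hq : F i ⬝ᵥ fim rounds σ Rmax p *ᵥ F i = 2 * (rounds : ℝ) / σ ^ 2 *
      ((∑ a, ∑ b, if (commGraph Rmax p).Adj a b then (F i a - F i b) ^ 2 else 0) / 2) := by
    rw [fim_eq, Matrix.smul_mulVec, dotProduct_smul, smul_eq_mul,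
      ← SimpleGraph.lapMatrix_toLinearMap₂', Matrix.toLinearMap₂'_apply']
  rw [hq] at h
  exact h

/-- `J† = J† J J†` inherits semidefiniteness from `J`. This allows crowded configurations to be
dropped from the expectation. -/
theorem rseb_nonneg (rounds : ℕ) (σ Rmax : ℝ) {n : ℕ} (p : Fin n → Plane) :
    0 ≤ rseb rounds σ Rmax p := by
  refine mul_nonneg (by positivity) (Finset.sum_nonneg fun i _ => ?_)
  have hpos := fim_posSemidef rounds σ Rmax p
  have hJ : (fim rounds σ Rmax p)ᵀ = fim rounds σ Rmax p := by
    rw [← Matrix.conjTranspose_eq_transpose_of_trivial]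
    exact hpos.isHermitian
  have h := (hpos.conjTranspose_mul_mul_same (pinv (fim rounds σ Rmax p))).diag_nonneg (i := i)
  rwa [Matrix.conjTranspose_eq_transpose_of_trivial, pinv_transpose hJ,
    (pinv_spec _).mul_mul_right] at h

/-! ### Counting pairs and triples by cell -/

section Counting

variable {ι G : Type*} [Fintype ι] [DecidableEq G]

/-- The number of indices that `c` sends to `g`. -/
def fiberCard (c : ι → G) (g : G) : ℕ := (Finset.univ.filter fun i => c i = g).card

theorem sum_comp_eq_sum_fiberCard (c : ι → G) (f : G → ℕ) :
    ∑ a, f (c a) = ∑ g ∈ Finset.univ.image c, fiberCard c g * f g := by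
  rw [Finset.sum_comp]
  rfl

theorem fiberCard_pos_iff {c : ι → G} {g : G} : fiberCard c g ≠ 0 ↔ g ∈ Finset.univ.image c := by
  rw [fiberCard, Finset.card_ne_zero, Finset.filter_nonempty_iff, Finset.mem_image]

variable [AddCommGroup G]

/-- Translating the fibres at most doubles the sum of their squares. -/
theorem sum_fiberCard_add_sq_le (c : ι → G) (d : G) :
    ∑ a, fiberCard c (c a + d) ^ 2 ≤ 2 * ∑ a, fiberCard c (c a) ^ 2 := by
  rw [sum_comp_eq_sum_fiberCard c fun g => fiberCard c (g + d) ^ 2,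
    sum_comp_eq_sum_fiberCard c fun g => fiberCard c g ^ 2]
  -- Grouped by fibres the sum is `∑ N_g N_{g+d}²`; the cube of the larger count bounds each term.
  have hle : ∀ x y : ℕ, x * y ^ 2 ≤ x * x ^ 2 + y * y ^ 2 := by
    intro x y
    rcases le_total x y with h | h
    · exact (Nat.mul_le_mul_right _ h).trans (Nat.le_add_left _ _)
    · exact (Nat.mul_le_mul_left _ (Nat.pow_le_pow_left h 2)).trans (Nat.le_add_right _ _)
  have hshift : ∑ g ∈ Finset.univ.image c, fiberCard c (g + d) * fiberCard c (g + d) ^ 2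
      ≤ ∑ g ∈ Finset.univ.image c, fiberCard c g * fiberCard c g ^ 2 := by
    refine (Finset.sum_map (Finset.univ.image c) (addRightEmbedding d)
      fun g => fiberCard c g * fiberCard c g ^ 2).symm.le.trans ?_
    refine Finset.sum_le_sum_of_ne_zero fun g _ hg => fiberCard_pos_iff.1 fun h => hg ?_
    rw [h, zero_mul]
  calc _ ≤ ∑ g ∈ Finset.univ.image c, (fiberCard c g * fiberCard c g ^ 2
        + fiberCard c (g + d) * fiberCard c (g + d) ^ 2) :=
      Finset.sum_le_sum fun g _ => hle _ _
    _ ≤ _ := by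
      rw [Finset.sum_add_distrib, two_mul]
      exact Nat.add_le_add_left hshift _

theorem sum_fiberCard_mul_le (c : ι → G) (d e : G) :
    ∑ a, fiberCard c (c a + d) * fiberCard c (c a + e) ≤ 2 * ∑ a, fiberCard c (c a) ^ 2 := by
  have h : 2 * ∑ a, fiberCard c (c a + d) * fiberCard c (c a + e)
      ≤ ∑ a, fiberCard c (c a + d) ^ 2 + ∑ a, fiberCard c (c a + e) ^ 2 := by
    rw [← Finset.sum_add_distrib, Finset.mul_sum]
    refine Finset.sum_le_sum fun a _ => ?_
    rw [← mul_assoc]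
    exact two_mul_le_add_sq _ _
  have h1 := sum_fiberCard_add_sq_le c d
  have h2 := sum_fiberCard_add_sq_le c e
  omega

/-- A sum over the indices in a translated window, sorted by fibres. -/
theorem sum_ite_mem_eq_sum_fiberCard (c : ι → G) (S : Finset G) (g : G) (k : G → ℝ) :
    (∑ i, if c i - g ∈ S then k (c i - g) else 0) = ∑ e ∈ S, k e * fiberCard c (g + e) := by
  have h : ∀ e ∈ S, k e * fiberCard c (g + e) = ∑ i, if c i - g = e then k e else 0 := by
    intro e _
    rw [← Finset.sum_filter, Finset.sum_const, nsmul_eq_mul, mul_comm, fiberCard]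
    simp only [sub_eq_iff_eq_add']
  rw [Finset.sum_congr rfl h, Finset.sum_comm]
  refine Finset.sum_congr rfl fun i _ => ?_
  rw [Finset.sum_ite_eq]

/-- The number of triples in which the second and third index are close to the first one,
weighted by a kernel, is controlled by the sum of the cubes of the fibre sizes. -/
theorem sum_window_mul_window_le (c : ι → G) (S T : Finset G) {k : G → ℝ} (hk : ∀ e, 0 ≤ k e) :
    ∑ a, (∑ i, if c i - c a ∈ S then k (c i - c a) else 0) *
        (∑ b, if c b - c a ∈ T then (1 : ℝ) else 0)
      ≤ 2 * (∑ a, (fiberCard c (c a) : ℝ) ^ 2) * T.card * ∑ e ∈ S, k e := by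
  have h1 : ∀ a, (∑ i, if c i - c a ∈ S then k (c i - c a) else 0) *
        (∑ b, if c b - c a ∈ T then (1 : ℝ) else 0)
      = ∑ e ∈ S, ∑ d ∈ T, k e * ((fiberCard c (c a + e) * fiberCard c (c a + d) : ℕ) : ℝ) := by
    intro a
    rw [sum_ite_mem_eq_sum_fiberCard, sum_ite_mem_eq_sum_fiberCard c T (c a) fun _ => 1,
      Finset.sum_mul_sum]
    refine Finset.sum_congr rfl fun e _ => Finset.sum_congr rfl fun d _ => ?_
    push_cast
    ring
  rw [Finset.sum_congr rfl fun a _ => h1 a, Finset.sum_comm, Finset.mul_sum]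
  refine Finset.sum_le_sum fun e _ => ?_
  rw [Finset.sum_comm]
  have h2 : ∀ d ∈ T, ∑ a, k e * ((fiberCard c (c a + e) * fiberCard c (c a + d) : ℕ) : ℝ)
      ≤ k e * (2 * ∑ a, (fiberCard c (c a) : ℝ) ^ 2) := by
    intro d _
    rw [← Finset.mul_sum]
    refine mul_le_mul_of_nonneg_left ?_ (hk e)
    exact_mod_cast sum_fiberCard_mul_le c e d
  refine (Finset.sum_le_sum h2).trans (le_of_eq ?_)
  rw [Finset.sum_const, nsmul_eq_mul]
  ring

/-- The number of pairs at bounded displacement. -/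
theorem sum_window_le (c : ι → G) (S : Finset G) :
    ∑ a, (∑ i, if c i - c a ∈ S then (1 : ℝ) else 0)
      ≤ 2 * (∑ a, (fiberCard c (c a) : ℝ) ^ 2) * S.card := by
  have h1 : ∀ a, (∑ i, if c i - c a ∈ S then (1 : ℝ) else 0)
      = ∑ e ∈ S, (fiberCard c (c a + e) : ℝ) := by
    intro a
    rw [sum_ite_mem_eq_sum_fiberCard c S (c a) fun _ => 1]
    simp
  rw [Finset.sum_congr rfl fun a _ => h1 a, Finset.sum_comm]
  have h2 : ∀ e ∈ S, ∑ a, (fiberCard c (c a + e) : ℝ)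
      ≤ 2 * ∑ a, (fiberCard c (c a) : ℝ) ^ 2 := by
    intro e _
    -- Squaring is wasteful here, but lets one crowding quantity control both pairs and triples.
    have h3 : ∑ a, fiberCard c (c a + e) ≤ ∑ a, fiberCard c (c a + e) ^ 2 :=
      Finset.sum_le_sum fun a _ => Nat.le_self_pow two_ne_zero _
    exact_mod_cast h3.trans (sum_fiberCard_add_sq_le c e)
  refine (Finset.sum_le_sum h2).trans (le_of_eq ?_)
  rw [Finset.sum_const, nsmul_eq_mul]
  ring

end Counting

/-! ### Inverse-square sums on the square lattice -/

section Lattice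

/-- The sup norm on the square lattice. -/
noncomputable def supNorm (e : ℤ × ℤ) : ℕ := max e.1.natAbs e.2.natAbs

/-- The ball of the square lattice for the sup norm. -/
noncomputable def box (m : ℕ) : Finset (ℤ × ℤ) := Finset.Icc (-(m : ℤ)) m ×ˢ Finset.Icc (-(m : ℤ)) m

theorem mem_box {m : ℕ} {e : ℤ × ℤ} : e ∈ box m ↔ supNorm e ≤ m := by
  simp only [box, supNorm, Finset.mem_product, Finset.mem_Icc]
  omega

theorem card_box (m : ℕ) : (box m).card = (2 * m + 1) ^ 2 := by
  have h : ((m : ℤ) + 1 - -(m : ℤ)).toNat = 2 * m + 1 := by omega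
  rw [box, Finset.card_product, Int.card_Icc, h, sq]

/-- In the plane, the inverse square of the distance sums to a logarithm. -/
theorem sum_box_le (m : ℕ) :
    ∑ e ∈ box m, 1 / (1 + (supNorm e : ℝ)) ^ 2 ≤ 1 + 8 * (harmonic m : ℝ) := by
  induction m with
  | zero =>
    have h : box 0 = {0} := by simp [box, ← Prod.zero_eq_mk]
    simp [h, supNorm]
  | succ m ih =>
    have hsub : box m ⊆ box (m + 1) := fun e he => mem_box.2 ((mem_box.1 he).trans m.le_succ)
    rw [← Finset.sum_sdiff hsub, harmonic_succ]
    have hval : ∀ e ∈ box (m + 1) \ box m,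
        1 / (1 + (supNorm e : ℝ)) ^ 2 = 1 / ((m : ℝ) + 2) ^ 2 := by
      intro e he
      rw [Finset.mem_sdiff, mem_box, mem_box] at he
      have : supNorm e = m + 1 := by omega
      rw [this]
      push_cast
      ring_nf
    -- The shell of sup norm `m + 1` has `8(m+1)` points of weight `1/(m+2)²`, so it adds at most
    -- `8/(m+1)`: a harmonic term.
    have hcard : (box (m + 1) \ box m).card = 8 * (m + 1) := by
      rw [Finset.card_sdiff_of_subset hsub, card_box, card_box]
      have : (2 * (m + 1) + 1) ^ 2 = 8 * (m + 1) + (2 * m + 1) ^ 2 := by ring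
      omega
    rw [Finset.sum_congr rfl hval, Finset.sum_const, hcard, nsmul_eq_mul]
    have h1 : ((8 * (m + 1) : ℕ) : ℝ) * (1 / ((m : ℝ) + 2) ^ 2) ≤ 8 * ((m : ℝ) + 1)⁻¹ := by
      push_cast
      rw [mul_one_div, ← div_eq_mul_inv, div_le_div_iff₀ (by positivity) (by positivity)]
      nlinarith [(Nat.cast_nonneg m : (0 : ℝ) ≤ m)]
    push_cast at h1 ⊢
    linarith

end Lattice

/-! ### Division of the plane into square cells -/

section Cells

/-- The index of the square of side `h` that contains a point of the plane. -/
noncomputable def cell (h : ℝ) (x : Plane) : ℤ × ℤ := (⌊x 0 / h⌋, ⌊x 1 / h⌋)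

theorem abs_apply_sub_le_dist (x y : Plane) (i : Fin 2) : |x i - y i| ≤ dist x y := by
  rw [dist_eq_norm, ← Real.norm_eq_abs]
  exact PiLp.norm_apply_le (x - y) i

theorem abs_floor_sub_floor_lt (x y : ℝ) : ((⌊x⌋ - ⌊y⌋).natAbs : ℝ) < |x - y| + 1 := by
  rw [Nat.cast_natAbs, Int.cast_abs, Int.cast_sub]
  have h1 := Int.floor_le x
  have h2 := Int.lt_floor_add_one x
  have h3 := Int.floor_le y
  have h4 := Int.lt_floor_add_one y
  have h5 := le_abs_self (x - y)
  have h6 := neg_abs_le (x - y)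
  rw [abs_lt]
  constructor <;> linarith

theorem supNorm_cell_sub_le {h : ℝ} (hh : 0 < h) (x y : Plane) :
    (supNorm (cell h x - cell h y) : ℝ) ≤ dist x y / h + 1 := by
  have key : ∀ i : Fin 2, ((⌊x i / h⌋ - ⌊y i / h⌋).natAbs : ℝ) ≤ dist x y / h + 1 := by
    intro i
    refine (abs_floor_sub_floor_lt _ _).le.trans ?_
    rw [← sub_div, abs_div, abs_of_pos hh]
    gcongr
    exact abs_apply_sub_le_dist x y i
  rw [supNorm, Nat.cast_max]
  exact max_le (key 0) (key 1)

/-- The crude factor `2` in place of `√2` suffices: at side `Rmax / 2`, agents sharing a cell are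
within range. -/
theorem dist_le_of_cell_eq {h : ℝ} (hh : 0 < h) {x y : Plane} (hxy : cell h x = cell h y) :
    dist x y ≤ 2 * h := by
  have key : ∀ i : Fin 2, ⌊x i / h⌋ = ⌊y i / h⌋ → (x i - y i) ^ 2 ≤ h ^ 2 := by
    intro i hi
    have h1 := Int.abs_sub_lt_one_of_floor_eq_floor hi
    rw [← sub_div, abs_div, abs_of_pos hh, div_lt_one hh] at h1
    exact sq_le_sq' (by linarith [neg_abs_le (x i - y i)]) ((le_abs_self _).trans h1.le)
  have h0 := key 0 (congrArg Prod.fst hxy)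
  have h1 := key 1 (congrArg Prod.snd hxy)
  rw [EuclideanSpace.dist_eq, Real.sqrt_le_left (by positivity), Fin.sum_univ_two,
    Real.dist_eq, Real.dist_eq, sq_abs, sq_abs]
  nlinarith

theorem measurable_cell (h : ℝ) : Measurable (cell h) := by
  unfold cell
  fun_prop

/-- The number of agents in the cell of agent `i`, agent `i` included. -/
noncomputable def cellCount (h : ℝ) {n : ℕ} (p : Fin n → Plane) (i : Fin n) : ℕ :=
  fiberCard (fun j => cell h (p j)) (cell h (p i))

end Cells

/-! ### Logarithmic potentials on a connected network -/

section LogarithmicPotential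

/-- The increment is at most the inverse of the smaller argument. Both inverse squares are kept on
the right, so that it does not matter which end of a link is nearer to the centre. -/
theorem sq_log_sub_log_le {x y : ℝ} (hx : 0 ≤ x) (hy : 0 ≤ y) (hxy : |x - y| ≤ 1) :
    (Real.log (1 + x) - Real.log (1 + y)) ^ 2 ≤ ((1 + x)⁻¹) ^ 2 + ((1 + y)⁻¹) ^ 2 := by
  wlog h : y ≤ x generalizing x y
  · have := this hy hx (by rwa [abs_sub_comm]) (le_of_not_ge h)
    nlinarith
  have h1 : 0 ≤ Real.log (1 + x) - Real.log (1 + y) :=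
    sub_nonneg.2 (Real.log_le_log (by linarith) (by linarith))
  have h2 : Real.log (1 + x) - Real.log (1 + y) ≤ (1 + y)⁻¹ := by
    rw [← Real.log_div (by linarith) (by linarith)]
    refine (Real.log_le_sub_one_of_pos (by positivity)).trans ?_
    rw [div_sub_one (by linarith), inv_eq_one_div]
    gcongr
    linarith [le_abs_self (x - y)]
  have h3 := pow_le_pow_left₀ h1 h2 2
  have : 0 ≤ ((1 + x)⁻¹) ^ 2 := by positivity
  linarith

theorem dist_le_of_walk {Rmax : ℝ} {n : ℕ} {p : Fin n → Plane} {i j : Fin n}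
    (w : (commGraph Rmax p).Walk i j) : dist (p i) (p j) ≤ w.length * Rmax := by
  induction w with
  | nil => simp
  | @cons u v w hadj q ih =>
    have h1 : dist (p u) (p v) ≤ Rmax := hadj.2
    have h2 := dist_triangle (p u) (p v) (p w)
    rw [SimpleGraph.Walk.length_cons]
    push_cast
    linarith

/-- The diameter of a connected network is at most the number of agents times the range. -/
theorem dist_le_of_connected {Rmax : ℝ} (hR : 0 < Rmax) {n : ℕ} {p : Fin n → Plane}
    (hp : (commGraph Rmax p).Connected) (i j : Fin n) : dist (p i) (p j) ≤ n * Rmax := by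
  obtain ⟨w, hw⟩ := (hp.preconnected i j).exists_isPath
  refine (dist_le_of_walk w).trans ?_
  have h := hw.length_lt
  rw [Fintype.card_fin] at h
  have : (w.length : ℝ) ≤ n := by exact_mod_cast h.le
  gcongr

variable {Rmax : ℝ} {n : ℕ} {p : Fin n → Plane}

/-- Cells of side `Rmax / 2` give `1 + supNorm ≤ 2(1 + dist/Rmax)`, hence the factor `4`. The finite
window comes from connectivity, not from the shape of the region: the diameter is at most `n *
Rmax`, so displacements are at most `2n + 1 ≤ 3n`. -/
theorem inv_sq_le_kernel (hR : 0 < Rmax) (hp : (commGraph Rmax p).Connected) (i a : Fin n) :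
    ((1 + dist (p i) (p a) / Rmax)⁻¹) ^ 2
      ≤ if cell (Rmax / 2) (p i) - cell (Rmax / 2) (p a) ∈ box (3 * n) then
        4 * (1 / (1 + (supNorm (cell (Rmax / 2) (p i) - cell (Rmax / 2) (p a)) : ℝ)) ^ 2)
        else 0 := by
  have h1 := supNorm_cell_sub_le (half_pos hR) (p i) (p a)
  have h2 := (div_le_iff₀ hR).2 (dist_le_of_connected hR hp i a)
  have h3 : dist (p i) (p a) / (Rmax / 2) = 2 * (dist (p i) (p a) / Rmax) := by
    field_simp
  rw [h3] at h1
  have hn : (1 : ℝ) ≤ n := by exact_mod_cast i.pos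
  rw [if_pos]
  · have h4 : 0 ≤ dist (p i) (p a) / Rmax := by positivity
    rw [inv_pow, mul_one_div, inv_eq_one_div, div_le_div_iff₀ (by positivity) (by positivity),
      one_mul]
    have h5 := pow_le_pow_left₀ (by positivity) (show
      1 + (supNorm (cell (Rmax / 2) (p i) - cell (Rmax / 2) (p a)) : ℝ)
        ≤ 2 * (1 + dist (p i) (p a) / Rmax) by linarith) 2
    linarith
  · rw [mem_box]
    have : (supNorm (cell (Rmax / 2) (p i) - cell (Rmax / 2) (p a)) : ℝ) ≤ ((3 * n : ℕ) : ℝ) := by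
      push_cast
      linarith
    exact_mod_cast this

/-- A link spans at most two cell sides, plus one for rounding; `box 3` has 49 elements. -/
theorem cell_sub_mem_box_of_adj (hR : 0 < Rmax) {a b : Fin n} (h : (commGraph Rmax p).Adj a b) :
    cell (Rmax / 2) (p b) - cell (Rmax / 2) (p a) ∈ box 3 := by
  have h1 := supNorm_cell_sub_le (half_pos hR) (p b) (p a)
  have h2 : dist (p b) (p a) / (Rmax / 2) ≤ 2 := by
    rw [div_le_iff₀ (half_pos hR), dist_comm]
    linarith [h.2]
  rw [mem_box]
  have : (supNorm (cell (Rmax / 2) (p b) - cell (Rmax / 2) (p a)) : ℝ) ≤ (3 : ℕ) := by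
    push_cast
    linarith
  exact_mod_cast this

open Classical in
/-- The Dirichlet energy of the logarithmic potential centred at agent `i`. -/
theorem energy_le (hR : 0 < Rmax) (p : Fin n → Plane) (i : Fin n) :
    (∑ a, ∑ b, if (commGraph Rmax p).Adj a b then
        (-Real.log (1 + dist (p i) (p a) / Rmax) - -Real.log (1 + dist (p i) (p b) / Rmax)) ^ 2
        else 0) / 2
      ≤ ∑ a, ∑ b, if (commGraph Rmax p).Adj a b then
        ((1 + dist (p i) (p a) / Rmax)⁻¹) ^ 2 else 0 := by
  -- Exchanging the ends of a link shows that both inverse squares contribute equally, which absorbs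
  -- the factor `1/2`.
  have hswap : ∑ a, ∑ b, (if (commGraph Rmax p).Adj a b then
        ((1 + dist (p i) (p b) / Rmax)⁻¹) ^ 2 else 0)
      = ∑ a, ∑ b, if (commGraph Rmax p).Adj a b then
        ((1 + dist (p i) (p a) / Rmax)⁻¹) ^ 2 else 0 := by
    rw [Finset.sum_comm]
    simp only [SimpleGraph.adj_comm]
  have hle : ∑ a, ∑ b, (if (commGraph Rmax p).Adj a b then
      (-Real.log (1 + dist (p i) (p a) / Rmax) - -Real.log (1 + dist (p i) (p b) / Rmax)) ^ 2
      else 0) ≤ ∑ a, ∑ b, ((if (commGraph Rmax p).Adj a b then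
          ((1 + dist (p i) (p b) / Rmax)⁻¹) ^ 2 else 0)
        + if (commGraph Rmax p).Adj a b then
          ((1 + dist (p i) (p a) / Rmax)⁻¹) ^ 2 else 0) := by
    refine Finset.sum_le_sum fun a _ => Finset.sum_le_sum fun b _ => ?_
    split_ifs with hab
    · rw [neg_sub_neg]
      refine sq_log_sub_log_le (by positivity) (by positivity) ?_
      rw [← sub_div, abs_div, abs_of_pos hR, div_le_one hR]
      refine le_trans ?_ hab.2
      have h := abs_dist_sub_le (p b) (p a) (p i)
      rwa [dist_comm (p b) (p i), dist_comm (p a) (p i), dist_comm (p b) (p a)] at h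
    · simp
  simp only [Finset.sum_add_distrib] at hle
  rw [hswap] at hle
  linarith

theorem sum_kernel_le (hn : 0 < n) :
    ∑ e ∈ box (3 * n), 4 * (1 / (1 + (supNorm e : ℝ)) ^ 2) ≤ 4 * (25 + 8 * Real.log n) := by
  rw [← Finset.mul_sum]
  -- The constant is `1 + 8(1 + log 3) ≤ 25`, using `log 3 ≤ 2`.
  refine mul_le_mul_of_nonneg_left ((sum_box_le _).trans ?_) (by norm_num)
  have h1 := harmonic_le_one_add_log (3 * n)
  push_cast at h1
  rw [Real.log_mul (by norm_num) (by positivity)] at h1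
  have h3 := Real.log_le_sub_one_of_pos (show (0 : ℝ) < 3 by norm_num)
  linarith

open Classical in
/-- The total Dirichlet energy of the logarithmic potentials centred at all the agents. -/
theorem sum_energy_le (hR : 0 < Rmax) (hp : (commGraph Rmax p).Connected) :
    ∑ i, (∑ a, ∑ b, if (commGraph Rmax p).Adj a b then
        (-Real.log (1 + dist (p i) (p a) / Rmax) - -Real.log (1 + dist (p i) (p b) / Rmax)) ^ 2
        else 0) / 2
      ≤ 392 * (∑ a, (cellCount (Rmax / 2) p a : ℝ) ^ 2) * (25 + 8 * Real.log n) := by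
  set w : Fin n → Fin n → ℝ := fun i a => ((1 + dist (p i) (p a) / Rmax)⁻¹) ^ 2 with hw
  set c : Fin n → ℤ × ℤ := fun i => cell (Rmax / 2) (p i) with hc
  obtain ⟨i₀⟩ := hp.nonempty
  have hsum := sum_window_mul_window_le c (box (3 * n)) (box 3)
    (k := fun e => 4 * (1 / (1 + (supNorm e : ℝ)) ^ 2)) (fun e => by positivity)
  have hcube : 0 ≤ 2 * (∑ a, (fiberCard c (c a) : ℝ) ^ 2) * (box 3).card := by positivity
  have hcard : ((box 3).card : ℝ) = 49 := by
    rw [card_box]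
    norm_num
  have hker := mul_le_mul_of_nonneg_left (sum_kernel_le i₀.pos) hcube
  calc _ ≤ ∑ i, ∑ a, ∑ b, (if (commGraph Rmax p).Adj a b then w i a else 0) :=
      Finset.sum_le_sum fun i _ => energy_le hR p i
    -- With `a` fixed, the centre `i` and the neighbour `b` range over independent windows around
    -- its cell. The final constant is `392 = 2 · 49 · 4`: translated fibres, link displacements,
    -- kernel.
    _ = ∑ a, ∑ i, ∑ b, (if (commGraph Rmax p).Adj a b then w i a else 0) := Finset.sum_comm
    _ ≤ ∑ a, (∑ i, if c i - c a ∈ box (3 * n) then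
          4 * (1 / (1 + (supNorm (c i - c a) : ℝ)) ^ 2) else 0) *
        (∑ b, if c b - c a ∈ box 3 then (1 : ℝ) else 0) := by
      refine Finset.sum_le_sum fun a _ => ?_
      rw [Finset.sum_mul_sum]
      refine Finset.sum_le_sum fun i _ => Finset.sum_le_sum fun b _ => ?_
      have hk := inv_sq_le_kernel hR hp i a
      have hk0 : 0 ≤ w i a := sq_nonneg _
      by_cases hab : (commGraph Rmax p).Adj a b
      · rw [if_pos hab, if_pos (cell_sub_mem_box_of_adj hR hab), mul_one]
        exact hk
      · rw [if_neg hab]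
        exact mul_nonneg (hk0.trans hk) (by split_ifs <;> norm_num)
    _ ≤ _ := hsum.trans (hker.trans_eq ?_)
  rw [hcard]
  change 2 * (∑ a, (cellCount (Rmax / 2) p a : ℝ) ^ 2) * 49 * _ = _
  ring

/-- If the cells are not too crowded, most pairs of agents are far apart. -/
theorem sum_log_dist_ge (hR : 0 < Rmax) (r : ℕ)
    (hr : 4 * (∑ a, (cellCount (Rmax / 2) p a : ℝ) ^ 2) * (2 * r + 1) ^ 2 ≤ (n : ℝ) ^ 2) :
    (n : ℝ) ^ 2 / 2 * Real.log (1 + r / 2)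
      ≤ ∑ a, ∑ i, Real.log (1 + dist (p i) (p a) / Rmax) := by
  set c : Fin n → ℤ × ℤ := fun i => cell (Rmax / 2) (p i) with hc
  have hlog : 0 ≤ Real.log (1 + (r : ℝ) / 2) :=
    Real.log_nonneg (by linarith [show (0 : ℝ) ≤ r / 2 by positivity])
  have hpt : ∀ a i, Real.log (1 + r / 2) * (1 - if c i - c a ∈ box r then 1 else 0)
      ≤ Real.log (1 + dist (p i) (p a) / Rmax) := by
    intro a i
    have hd : 0 ≤ dist (p i) (p a) / Rmax := by positivity
    split_ifs with h
    · rw [sub_self, mul_zero]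
      exact Real.log_nonneg (by linarith)
    · rw [sub_zero, mul_one]
      refine Real.log_le_log (by positivity) ?_
      have h1 := supNorm_cell_sub_le (half_pos hR) (p i) (p a)
      have h3 : dist (p i) (p a) / (Rmax / 2) = 2 * (dist (p i) (p a) / Rmax) := by
        field_simp
      rw [mem_box, not_le] at h
      have h4 : (r : ℝ) + 1 ≤ supNorm (c i - c a) := by exact_mod_cast h
      simp only [hc] at h4
      linarith
  -- By `hr`, at most half of the `n²` ordered pairs have displacement in `box r`; the others are at
  -- distance at least `Rmax * r / 2`.
  have hcount := sum_window_le c (box r)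
  rw [card_box] at hcount
  push_cast at hcount
  have hsum : ∑ a, ∑ i, (Real.log (1 + r / 2) * (1 - if c i - c a ∈ box r then 1 else 0))
      = Real.log (1 + r / 2) * ((n : ℝ) ^ 2 - ∑ a, ∑ i, if c i - c a ∈ box r then 1 else 0) := by
    simp only [← Finset.mul_sum, Finset.sum_sub_distrib]
    simp [sq]
  have hle : ∑ a, ∑ i, (Real.log (1 + r / 2) * (1 - if c i - c a ∈ box r then 1 else 0))
      ≤ ∑ a, ∑ i, Real.log (1 + dist (p i) (p a) / Rmax) :=
    Finset.sum_le_sum fun a _ => Finset.sum_le_sum fun i _ => hpt a i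
  refine le_trans ?_ hle
  rw [hsum, mul_comm]
  refine mul_le_mul_of_nonneg_left ?_ hlog
  simp only [cellCount] at hr
  linarith

end LogarithmicPotential

/-! ### The logarithmic lower bound for uncrowded networks -/

/-- A connected network whose cells are not too crowded on average has a relative
synchronization error bound of logarithmic order. -/
theorem rseb_ge_log {rounds : ℕ} {σ Rmax : ℝ} (hr : 0 < rounds) (hσ : 0 < σ) (hR : 0 < Rmax)
    {Q : ℝ} (hQ : 0 < Q) {n : ℕ} (hn : 36 * Q ≤ n.sqrt) {p : Fin n → Plane}
    (hp : (commGraph Rmax p).Connected)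
    (hcount : ∑ a, (cellCount (Rmax / 2) p a : ℝ) ^ 2 ≤ Q * n) :
    (Real.log n - 12) / (64 * (3136 * (2 * rounds / σ ^ 2) * Q)) ≤ rseb rounds σ Rmax p := by
  classical
  obtain ⟨i₀⟩ := hp.nonempty
  have hn0 : (0 : ℝ) < n := by exact_mod_cast i₀.pos
  set κ : ℝ := 2 * rounds / σ ^ 2 with hκ
  have hκ0 : 0 < κ := by positivity
  set A : ℝ := 3136 * κ * Q with hA
  have hA0 : 0 < A := by positivity
  set s : ℕ := n.sqrt with hs
  -- `r` is about `n^(1/4)`: a boxful `(2r+1)² ≤ 9√n` is negligible against `n`, yet `log r` is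
  -- still of order `log n`.
  set r : ℕ := s.sqrt with hrdef
  have hsn : (s : ℝ) * s ≤ n := by exact_mod_cast n.sqrt_le
  have hrs : (r : ℝ) * r ≤ s := by exact_mod_cast s.sqrt_le
  have hs1 : 1 ≤ s := Nat.le_sqrt.2 i₀.pos
  have hr1 : 1 ≤ r := Nat.le_sqrt.2 hs1
  have hr1' : (1 : ℝ) ≤ r := by exact_mod_cast hr1
  have hs1' : (1 : ℝ) ≤ s := by exact_mod_cast hs1
  have hlogr : Real.log n / 4 - 1 ≤ Real.log (1 + r / 2) := by
    have h1 : (n : ℝ) ≤ ((r : ℝ) + 1) ^ 4 := by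
      have h2 : n < (s + 1) * (s + 1) := Nat.lt_succ_sqrt n
      have h3 : s + 1 ≤ (r + 1) * (r + 1) := Nat.lt_succ_sqrt s
      have h4 : n ≤ (r + 1) ^ 4 := h2.le.trans ((Nat.mul_le_mul h3 h3).trans (by ring_nf; rfl))
      exact_mod_cast h4
    have h2 := Real.log_le_log hn0 h1
    rw [Real.log_pow] at h2
    have h3 : Real.log (((r : ℝ) + 1) / 2) ≤ Real.log (1 + r / 2) :=
      Real.log_le_log (by positivity) (by linarith)
    rw [Real.log_div (by positivity) (by norm_num)] at h3
    have h4 := Real.log_le_sub_one_of_pos (show (0 : ℝ) < 2 by norm_num)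
    push_cast at h2
    linarith
  have hfar : 4 * (∑ a, (cellCount (Rmax / 2) p a : ℝ) ^ 2) * (2 * r + 1) ^ 2 ≤ (n : ℝ) ^ 2 := by
    have h1 : (2 * (r : ℝ) + 1) ^ 2 ≤ 9 * s := by nlinarith
    calc 4 * (∑ a, (cellCount (Rmax / 2) p a : ℝ) ^ 2) * (2 * r + 1) ^ 2
        ≤ 4 * (Q * n) * (9 * s) := by gcongr
      _ = (36 * Q) * s * n := by ring
      _ ≤ s * s * n := by gcongr
      _ ≤ n * n := by gcongr
      _ = (n : ℝ) ^ 2 := by ring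
  have hS := sum_log_dist_ge hR r hfar
  have hE := sum_energy_le hR hp
  have hE' : 392 * (∑ a, (cellCount (Rmax / 2) p a : ℝ) ^ 2) * (25 + 8 * Real.log n)
      ≤ 392 * (Q * n) * (25 + 8 * Real.log n) := by
    have := Real.log_nonneg (show (1 : ℝ) ≤ n by exact_mod_cast i₀.pos)
    gcongr
  -- To leading order the bound per agent is `t L/4 - t² A L` with `L = log n`, which is largest at
  -- `t = 1/(8A)`; `3136 = 8 · 392`.
  set t : ℝ := 1 / (8 * A) with ht
  have ht0 : 0 < t := by positivity
  have h := rseb_ge hr hσ Rmax hp (fun i a => -Real.log (1 + dist (p i) (p a) / Rmax)) t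
  refine le_trans ?_ h
  rw [Finset.sum_sub_distrib, ← Finset.mul_sum, ← Finset.mul_sum, ← Finset.mul_sum]
  have hmean : ∑ i, ((-Real.log (1 + dist (p i) (p i) / Rmax))
      - (∑ j, -Real.log (1 + dist (p i) (p j) / Rmax)) / n)
      = (∑ a, ∑ i, Real.log (1 + dist (p i) (p a) / Rmax)) / n := by
    rw [Finset.sum_comm, Finset.sum_div]
    refine Finset.sum_congr rfl fun i _ => ?_
    rw [dist_self, zero_div, add_zero, Real.log_one, Finset.sum_neg_distrib]
    ring
  rw [hmean]
  set L : ℝ := Real.log n with hL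
  have hL0 : 0 ≤ L := Real.log_nonneg (by exact_mod_cast i₀.pos)
  have hS' : (n : ℝ) / 2 * (L / 4 - 1)
      ≤ (∑ a, ∑ i, Real.log (1 + dist (p i) (p a) / Rmax)) / n := by
    rw [le_div_iff₀ hn0]
    refine le_trans ?_ hS
    have : (n : ℝ) ^ 2 / 2 * (L / 4 - 1) ≤ (n : ℝ) ^ 2 / 2 * Real.log (1 + r / 2) := by gcongr
    linarith
  have hEall := hE.trans hE'
  have hmain : (n : ℝ)⁻¹ * (2 * t * ((n : ℝ) / 2 * (L / 4 - 1))
      - t ^ 2 * (κ * (392 * (Q * n) * (25 + 8 * L)))) ≤ (n : ℝ)⁻¹ *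
      (2 * t * ((∑ a, ∑ i, Real.log (1 + dist (p i) (p a) / Rmax)) / n)
      - t ^ 2 * (κ * ∑ i, (∑ a, ∑ b, if (commGraph Rmax p).Adj a b then
        (-Real.log (1 + dist (p i) (p a) / Rmax) - -Real.log (1 + dist (p i) (p b) / Rmax)) ^ 2
        else 0) / 2)) := by
    gcongr
  refine le_trans ?_ hmain
  have hval : (n : ℝ)⁻¹ * (2 * t * ((n : ℝ) / 2 * (L / 4 - 1))
      - t ^ 2 * (κ * (392 * (Q * n) * (25 + 8 * L)))) = (L - 89 / 8) / (64 * A) := by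
    rw [ht, hA]
    field_simp
    ring
  rw [hval]
  gcongr
  norm_num

/-! ### Redundant agents -/

section Removal

/-- Agent `i` is redundant if the network stays connected without it and its cell stays
occupied. -/
def Redundant (Rmax : ℝ) {k : ℕ} (p : Fin (k + 1) → Plane) (i : Fin (k + 1)) : Prop :=
  (commGraph Rmax (i.removeNth p)).Connected ∧
    ∃ j, cell (Rmax / 2) (i.removeNth p j) = cell (Rmax / 2) (p i)

theorem dist_le_of_cell_half_eq {Rmax : ℝ} (hR : 0 < Rmax) {x y : Plane}
    (hxy : cell (Rmax / 2) x = cell (Rmax / 2) y) : dist x y ≤ Rmax := by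
  have := dist_le_of_cell_eq (half_pos hR) hxy
  linarith

theorem reachable_of_dist_le {Rmax : ℝ} {n : ℕ} {p : Fin n → Plane} {i j : Fin n}
    (h : dist (p i) (p j) ≤ Rmax) : (commGraph Rmax p).Reachable i j := by
  by_cases hij : i = j
  · rw [hij]
  · exact SimpleGraph.Adj.reachable ⟨hij, h⟩

/-- If the other agents of the cell of agent `i` have the links into all the neighbouring cells
that agent `i` has, then agent `i` is redundant. -/
theorem redundant_of_links {Rmax : ℝ} (hR : 0 < Rmax) {k : ℕ} {p : Fin (k + 1) → Plane}
    (hp : (commGraph Rmax p).Connected) {i : Fin (k + 1)}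
    (hlink : ∀ v, dist (p i) (p v) ≤ Rmax → ∃ a b, a ≠ i ∧
      cell (Rmax / 2) (p a) = cell (Rmax / 2) (p i) ∧
      cell (Rmax / 2) (p b) = cell (Rmax / 2) (p v) ∧ dist (p a) (p b) ≤ Rmax) :
    Redundant Rmax p i := by
  obtain ⟨a₀, -, ha₀, hca₀, -⟩ := hlink i (by rw [dist_self]; exact hR.le)
  obtain ⟨j₀, hj₀⟩ := Fin.exists_succAbove_eq ha₀
  -- `φ` moves agent `i` onto its cell mate `j₀` and fixes all others; links of the full network
  -- become paths of the reduced one.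
  have hφ : ∀ u, ∃ j, (u ≠ i → i.succAbove j = u) ∧ (u = i → j = j₀) := by
    intro u
    by_cases hu : u = i
    · exact ⟨j₀, fun h => absurd hu h, fun _ => rfl⟩
    · obtain ⟨j, hj⟩ := Fin.exists_succAbove_eq hu
      exact ⟨j, fun _ => hj, fun h => absurd h hu⟩
  choose φ hφ1 hφ2 using hφ
  have hφs : ∀ j, φ (i.succAbove j) = j := fun j =>
    Fin.succAbove_right_injective (hφ1 _ (Fin.succAbove_ne i j))
  have hclose : ∀ u v, u ≠ i → v ≠ i → dist (p u) (p v) ≤ Rmax →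
      (commGraph Rmax (i.removeNth p)).Reachable (φ u) (φ v) := by
    intro u v hu hv h
    refine reachable_of_dist_le ?_
    rw [Fin.removeNth_apply, Fin.removeNth_apply, hφ1 u hu, hφ1 v hv]
    exact h
  have hφi : φ i = φ a₀ := by rw [hφ2 i rfl, ← hj₀, hφs]
  have hi : ∀ v, v ≠ i → dist (p i) (p v) ≤ Rmax →
      (commGraph Rmax (i.removeNth p)).Reachable (φ i) (φ v) := by
    intro v hv h
    obtain ⟨a, b, ha, hca, hcb, hab⟩ := hlink v h
    rw [hφi]
    -- The substitute link may end at `i` itself; then `v` shares the cell of `i`, and `a₀` reaches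
    -- it directly.
    by_cases hb : b = i
    · exact hclose _ _ ha₀ hv (dist_le_of_cell_half_eq hR (hca₀.trans (by rw [← hcb, hb])))
    · exact ((hclose _ _ ha₀ ha (dist_le_of_cell_half_eq hR (hca₀.trans hca.symm))).trans
        (hclose _ _ ha hb hab)).trans (hclose _ _ hb hv (dist_le_of_cell_half_eq hR hcb))
  have hadj : ∀ u v, (commGraph Rmax p).Adj u v →
      (commGraph Rmax (i.removeNth p)).Reachable (φ u) (φ v) := by
    intro u v huv
    by_cases hu : u = i
    · subst hu
      exact hi v huv.1.symm huv.2
    · by_cases hv : v = i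
      · subst hv
        exact (hi u hu (by rw [dist_comm]; exact huv.2)).symm
      · exact hclose u v hu hv huv.2
  have hwalk : ∀ u v, (commGraph Rmax p).Walk u v →
      (commGraph Rmax (i.removeNth p)).Reachable (φ u) (φ v) := by
    intro u v w
    induction w with
    | nil => exact SimpleGraph.Reachable.refl _
    | cons h _ ih => exact (hadj _ _ h).trans ih
  have : Nonempty (Fin k) := ⟨j₀⟩
  refine ⟨⟨fun u v => ?_⟩, j₀, ?_⟩
  · obtain ⟨w⟩ := hp.preconnected (i.succAbove u) (i.succAbove v)
    have := hwalk _ _ w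
    rwa [hφs, hφs] at this
  · rw [Fin.removeNth_apply, hj₀, hca₀]

open Classical in
/-- A cell of a connected network contains boundedly many agents that are not redundant. -/
theorem card_not_redundant_le {Rmax : ℝ} (hR : 0 < Rmax) {k : ℕ} {p : Fin (k + 1) → Plane}
    (hp : (commGraph Rmax p).Connected) (c : ℤ × ℤ) :
    (Finset.univ.filter fun i => cell (Rmax / 2) (p i) = c ∧ ¬ Redundant Rmax p i).card
      ≤ 49 := by
  -- One representative with a link is chosen for each displacement `e`; the value `0` is a dummy
  -- when there is no link. Only representatives can fail to be redundant.
  have hex : ∀ e : ℤ × ℤ, ∃ a : Fin (k + 1),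
      (∃ a b, cell (Rmax / 2) (p a) = c ∧ cell (Rmax / 2) (p b) = c + e ∧
        dist (p a) (p b) ≤ Rmax) →
      ∃ b, cell (Rmax / 2) (p a) = c ∧ cell (Rmax / 2) (p b) = c + e ∧
        dist (p a) (p b) ≤ Rmax := by
    intro e
    by_cases h : ∃ a b, cell (Rmax / 2) (p a) = c ∧ cell (Rmax / 2) (p b) = c + e ∧
        dist (p a) (p b) ≤ Rmax
    · obtain ⟨a, ha⟩ := h
      exact ⟨a, fun _ => ha⟩
    · exact ⟨0, fun h' => absurd h' h⟩
  choose a ha using hex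
  have hsub : (Finset.univ.filter fun i => cell (Rmax / 2) (p i) = c ∧ ¬ Redundant Rmax p i)
      ⊆ (box 3).image a := by
    intro i hi
    obtain ⟨hic, hir⟩ := (Finset.mem_filter.1 hi).2
    by_contra hnot
    refine hir (redundant_of_links hR hp fun v hv => ?_)
    by_cases hiv : v = i
    · obtain ⟨b, h1, h2, h3⟩ := ha 0 ⟨i, i, hic, by rw [add_zero, hic], by
        rw [dist_self]; exact hR.le⟩
      refine ⟨a 0, b, fun h => hnot ?_, h1.trans hic.symm, ?_, h3⟩
      · rw [← h]
        exact Finset.mem_image_of_mem a (mem_box.2 (by simp [supNorm]))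
      · rw [h2, hiv, add_zero, hic]
    · have hmem : cell (Rmax / 2) (p v) - c ∈ box 3 := by
        rw [← hic]
        exact cell_sub_mem_box_of_adj hR ⟨Ne.symm hiv, hv⟩
      obtain ⟨b, h1, h2, h3⟩ := ha (cell (Rmax / 2) (p v) - c) ⟨i, v, hic, by abel, hv⟩
      refine ⟨a _, b, fun h => hnot ?_, h1.trans hic.symm, ?_, h3⟩
      · rw [← h]
        exact Finset.mem_image_of_mem a hmem
      · rw [h2]
        abel
  exact (Finset.card_le_card hsub).trans
    (Finset.card_image_le.trans (by rw [card_box]; norm_num))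

open Classical in
/-- In a connected network the crowding of the cells is dominated by the redundant agents. -/
theorem sum_cellCount_pow_le {Rmax : ℝ} (hR : 0 < Rmax) {k : ℕ} {p : Fin (k + 1) → Plane}
    (hp : (commGraph Rmax p).Connected) (m : ℕ) :
    ∑ i, cellCount (Rmax / 2) p i ^ m
      ≤ 100 ^ m * (k + 1)
        + 2 * ∑ i, if Redundant Rmax p i then cellCount (Rmax / 2) p i ^ m else 0 := by
  set c : Fin (k + 1) → ℤ × ℤ := fun i => cell (Rmax / 2) (p i) with hc
  have hfib : ∀ f : Fin (k + 1) → ℕ, ∑ i, f i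
      = ∑ g ∈ Finset.univ.image c, ∑ i ∈ Finset.univ.filter (fun i => c i = g), f i := fun f =>
    (Finset.sum_fiberwise_of_maps_to (fun i hi => Finset.mem_image_of_mem c hi) f).symm
  have hcard : (100 ^ m * (k + 1) : ℕ) = ∑ _i : Fin (k + 1), 100 ^ m := by
    rw [Finset.sum_const, Finset.card_univ, Fintype.card_fin, smul_eq_mul, mul_comm]
  rw [hcard, hfib, hfib fun _ => 100 ^ m,
    hfib fun i => if Redundant Rmax p i then cellCount (Rmax / 2) p i ^ m else 0,
    Finset.mul_sum, ← Finset.sum_add_distrib]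
  refine Finset.sum_le_sum fun g _ => ?_
  set N : ℕ := fiberCard c g with hN
  have hval : ∀ i ∈ Finset.univ.filter (fun i => c i = g), cellCount (Rmax / 2) p i = N := by
    intro i hi
    rw [hN, ← (Finset.mem_filter.1 hi).2]
    rfl
  have h1 : ∑ i ∈ Finset.univ.filter (fun i => c i = g), cellCount (Rmax / 2) p i ^ m
      = N * N ^ m := by
    rw [Finset.sum_congr rfl fun i hi => by rw [hval i hi], Finset.sum_const, smul_eq_mul]
    rfl
  have h2 : ∑ _i ∈ Finset.univ.filter (fun i => c i = g), 100 ^ m = N * 100 ^ m := by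
    rw [Finset.sum_const, smul_eq_mul]
    rfl
  have h3 : ∑ i ∈ Finset.univ.filter (fun i => c i = g),
      (if Redundant Rmax p i then cellCount (Rmax / 2) p i ^ m else 0)
      = ((Finset.univ.filter (fun i => c i = g)).filter fun i => Redundant Rmax p i).card
        * N ^ m := by
    rw [← Finset.sum_filter, Finset.sum_congr rfl fun i hi => by
      rw [hval i (Finset.mem_filter.1 hi).1], Finset.sum_const, smul_eq_mul]
  rw [h1, h2, h3]
  have h4 := Finset.card_filter_add_card_filter_not
    (s := Finset.univ.filter (fun i => c i = g)) (fun i => Redundant Rmax p i)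
  have h5 := card_not_redundant_le hR hp g
  rw [← Finset.filter_filter] at h5
  set M := ((Finset.univ.filter (fun i => c i = g)).filter fun i => Redundant Rmax p i).card
  have h6 : N ≤ M + 49 := by
    refine h4.symm.le.trans (Nat.add_le_add_left ?_ M)
    convert h5
  -- In a cell of at least 100 agents more than half are redundant, as at most 49 are not; in
  -- smaller cells each term is at most `100^m`.
  rcases le_total N 100 with h | h
  · exact (Nat.mul_le_mul_left N (Nat.pow_le_pow_left h m)).trans (Nat.le_add_right _ _)
  · refine le_trans ?_ (Nat.le_add_left _ _)
    rw [← mul_assoc]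
    exact Nat.mul_le_mul_right _ (by omega)

end Removal

/-! ### Measurability of graph events -/

section Measurability

/-- There are finitely many graphs, and each is cut out by finitely many distance conditions. -/
theorem measurableSet_commGraph_mem (Rmax : ℝ) {n : ℕ} (T : Set (SimpleGraph (Fin n))) :
    MeasurableSet {p : Fin n → Plane | commGraph Rmax p ∈ T} := by
  have hG : ∀ G : SimpleGraph (Fin n), MeasurableSet {p : Fin n → Plane | commGraph Rmax p = G} := by
    intro G
    have h : {p : Fin n → Plane | commGraph Rmax p = G}
        = ⋂ i, ⋂ j, {p | (i ≠ j ∧ dist (p i) (p j) ≤ Rmax) ↔ G.Adj i j} := by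
      ext p
      simp only [Set.mem_ofPred_eq, Set.mem_iInter, SimpleGraph.ext_iff, funext_iff, eq_iff_iff]
      rfl
    rw [h]
    refine MeasurableSet.iInter fun i => MeasurableSet.iInter fun j => ?_
    have hd : MeasurableSet {p : Fin n → Plane | dist (p i) (p j) ≤ Rmax} :=
      measurableSet_le (by fun_prop) measurable_const
    exact ((MeasurableSet.const _).inter hd).iff (MeasurableSet.const _)
  have h : {p : Fin n → Plane | commGraph Rmax p ∈ T}
      = ⋃ G ∈ T, {p : Fin n → Plane | commGraph Rmax p = G} := by
    ext p
    simp
  rw [h]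
  exact MeasurableSet.biUnion (Set.to_countable T) fun G _ => hG G

/-- The configurations of agents that form a connected network. -/
def connectedSet (Rmax : ℝ) (n : ℕ) : Set (Fin n → Plane) := {p | (commGraph Rmax p).Connected}

theorem measurableSet_connectedSet (Rmax : ℝ) (n : ℕ) : MeasurableSet (connectedSet Rmax n) :=
  measurableSet_commGraph_mem Rmax {G | G.Connected}

open Classical in
theorem cellCount_eq_sum (h : ℝ) {n : ℕ} (p : Fin n → Plane) (i : Fin n) :
    cellCount h p i = ∑ j, if cell h (p j) = cell h (p i) then 1 else 0 := by
  rw [cellCount, fiberCard, Finset.card_filter]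

theorem measurableSet_cell_eq (h : ℝ) {α : Type*} [MeasurableSpace α] {f g : α → Plane}
    (hf : Measurable f) (hg : Measurable g) : MeasurableSet {a | cell h (f a) = cell h (g a)} :=
  measurableSet_eq_fun ((measurable_cell h).comp hf) ((measurable_cell h).comp hg)

theorem measurable_cellCount (h : ℝ) {n : ℕ} (i : Fin n) :
    Measurable fun p : Fin n → Plane => cellCount h p i := by
  classical
  simp only [cellCount_eq_sum]
  refine Finset.measurable_sum _ fun j _ => Measurable.ite ?_ measurable_const measurable_const
  exact measurableSet_cell_eq h (measurable_pi_apply j) (measurable_pi_apply i)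

end Measurability

/-! ### Adding and removing one random agent -/

section Resampling

variable {Rmax : ℝ} {ν : Measure Plane} [IsProbabilityMeasure ν]

open scoped ENNReal

/-- The points within communication range of one of the agents. -/
def coverage (Rmax : ℝ) {ι : Type*} (p : ι → Plane) : Set Plane := {x | ∃ i, dist x (p i) ≤ Rmax}

theorem measurableSet_coverage_prod (Rmax : ℝ) {ι : Type*} [Finite ι] :
    MeasurableSet {z : Plane × (ι → Plane) | z.1 ∈ coverage Rmax z.2} := by
  have h : {z : Plane × (ι → Plane) | z.1 ∈ coverage Rmax z.2}
      = ⋃ i, {z | dist z.1 (z.2 i) ≤ Rmax} := by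
    ext z
    simp [coverage]
  rw [h]
  exact MeasurableSet.iUnion fun i => measurableSet_le
    (measurable_fst.dist ((measurable_pi_apply i).comp measurable_snd)) measurable_const

theorem measurable_measure_coverage (Rmax : ℝ) (ν : Measure Plane) [SFinite ν] {ι : Type*}
    [Finite ι] : Measurable fun p : ι → Plane => ν (coverage Rmax p) :=
  measurable_measure_prodMk_right (measurableSet_coverage_prod Rmax)

/-- An agent within range of a connected network can join it. -/
theorem connected_of_removeNth {k : ℕ} {p : Fin (k + 1) → Plane} {i : Fin (k + 1)}
    (hp : (commGraph Rmax (i.removeNth p)).Connected)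
    (hi : p i ∈ coverage Rmax (i.removeNth p)) : (commGraph Rmax p).Connected := by
  obtain ⟨j₀, hj₀⟩ := hi
  have hmap : ∀ u v, (commGraph Rmax p).Reachable (i.succAbove u) (i.succAbove v) := by
    intro u v
    let f : commGraph Rmax (i.removeNth p) →g commGraph Rmax p :=
      ⟨i.succAbove, fun {a b} (hab : (commGraph Rmax (i.removeNth p)).Adj a b) =>
        (⟨fun h => hab.1 (Fin.succAbove_right_injective h), hab.2⟩ :
          (commGraph Rmax p).Adj (i.succAbove a) (i.succAbove b))⟩
    exact (hp.preconnected u v).map f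
  have hall : ∀ u, (commGraph Rmax p).Reachable (i.succAbove j₀) u := by
    intro u
    by_cases hu : u = i
    · subst hu
      exact (reachable_of_dist_le hj₀).symm
    · obtain ⟨v, rfl⟩ := Fin.exists_succAbove_eq hu
      exact hmap j₀ v
  have : Nonempty (Fin (k + 1)) := ⟨i⟩
  exact ⟨fun u v => (hall u).symm.trans (hall v)⟩

/-- One more agent joins a connected network with probability the measure of its coverage. -/
theorem lintegral_coverage_le (k : ℕ) :
    ∫⁻ q in connectedSet Rmax k, ν (coverage Rmax q) ∂(Measure.pi fun _ => ν)
      ≤ (Measure.pi fun _ => ν) (connectedSet Rmax (k + 1)) := by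
  have hmp := measurePreserving_piFinSuccAbove (fun _ : Fin (k + 1) => ν) 0
  set s : Set (Plane × (Fin k → Plane)) :=
    {z | z.1 ∈ coverage Rmax z.2} ∩ Prod.snd ⁻¹' connectedSet Rmax k with hs
  have hsm : MeasurableSet s := (measurableSet_coverage_prod Rmax).inter
    (measurable_snd (measurableSet_connectedSet Rmax k))
  have hsub : (MeasurableEquiv.piFinSuccAbove (fun _ : Fin (k + 1) => Plane) 0) ⁻¹' s
      ⊆ connectedSet Rmax (k + 1) := fun p hp => connected_of_removeNth (i := 0) hp.2 hp.1
  refine le_trans ?_ (measure_mono hsub)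
  rw [hmp.measure_preimage hsm.nullMeasurableSet, Measure.prod_apply_symm hsm,
    ← lintegral_indicator (measurableSet_connectedSet Rmax k)]
  refine lintegral_mono fun q => ?_
  by_cases hq : q ∈ connectedSet Rmax k
  · rw [Set.indicator_of_mem hq]
    exact measure_mono fun x hx => ⟨hx, hq⟩
  · rw [Set.indicator_of_notMem hq]
    exact zero_le

theorem cellCount_eq_add_of_removeNth (h : ℝ) {k : ℕ} (p : Fin (k + 1) → Plane)
    (i : Fin (k + 1)) (j : Fin k) (hj : cell h (i.removeNth p j) = cell h (p i)) :
    cellCount h p i = 1 + cellCount h (i.removeNth p) j := by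
  classical
  rw [cellCount_eq_sum, cellCount_eq_sum, Fin.sum_univ_succAbove _ i, if_pos rfl, hj]
  rfl

open Classical in
/-- If the cell of agent `i` stays occupied without it, a power of the crowding it sees is bounded
by a sum of lower powers over the other agents of that cell. -/
theorem cellCount_pow_succ_le {h : ℝ} {k : ℕ} {p : Fin (k + 1) → Plane} {i : Fin (k + 1)}
    (hi : ∃ j, cell h (i.removeNth p j) = cell h (p i)) (m : ℕ) :
    cellCount h p i ^ (m + 1) ≤ ∑ j, if cell h (p i) = cell h (i.removeNth p j) then
      2 ^ (m + 1) * cellCount h (i.removeNth p) j ^ m else 0 := by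
  obtain ⟨j, hj⟩ := hi
  set M := cellCount h (i.removeNth p) j with hM
  have hpos : 1 ≤ M := by
    rw [hM, cellCount, fiberCard, Nat.one_le_iff_ne_zero, Finset.card_ne_zero]
    exact ⟨j, by simp⟩
  have hval : ∀ j' ∈ Finset.univ.filter (fun j' => cell h (p i) = cell h (i.removeNth p j')),
      2 ^ (m + 1) * cellCount h (i.removeNth p) j' ^ m = 2 ^ (m + 1) * M ^ m := by
    intro j' hj'
    rw [hM, cellCount, cellCount, hj, (Finset.mem_filter.1 hj').2]
  have hcard : (Finset.univ.filter
      (fun j' => cell h (p i) = cell h (i.removeNth p j'))).card = M := by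
    rw [hM, cellCount, fiberCard, hj]
    congr 1
    ext j'
    simp [eq_comm]
  rw [← Finset.sum_filter, Finset.sum_congr rfl hval, Finset.sum_const, hcard, smul_eq_mul,
    cellCount_eq_add_of_removeNth h p i j hj]
  -- Occupancy gives `M ≥ 1`, hence `1 + M ≤ 2M`. One factor `M` is spent as the number of cell
  -- mates in the sum.
  calc (1 + M) ^ (m + 1) ≤ (2 * M) ^ (m + 1) := Nat.pow_le_pow_left (by omega) _
    _ = M * (2 ^ (m + 1) * M ^ m) := by ring

open Classical in
/-- The crowding seen by a redundant agent, after removing that agent. -/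
theorem lintegral_redundant_le {α : ℝ≥0∞}
    (hα : ∀ x, ν {y | cell (Rmax / 2) y = cell (Rmax / 2) x} ≤ α) (k m : ℕ) (i : Fin (k + 1)) :
    ∫⁻ p, (if Redundant Rmax p i then (cellCount (Rmax / 2) p i : ℝ≥0∞) ^ (m + 1) else 0)
        ∂(Measure.pi fun _ => ν)
      ≤ 2 ^ (m + 1) * α * ∫⁻ q in connectedSet Rmax k,
        ∑ j, (cellCount (Rmax / 2) q j : ℝ≥0∞) ^ m ∂(Measure.pi fun _ => ν) := by
  set h := Rmax / 2 with hh
  have hmp := measurePreserving_piFinSuccAbove (fun _ : Fin (k + 1) => ν) i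
  -- In `g` the removed agent enters only through its cell, so for fixed other agents integrating
  -- over it costs at most `α` per summand.
  set g : Plane × (Fin k → Plane) → ℝ≥0∞ := fun z =>
    ∑ j, if cell h z.1 = cell h (z.2 j) then
      2 ^ (m + 1) * (connectedSet Rmax k).indicator
        (fun q => (cellCount h q j : ℝ≥0∞) ^ m) z.2 else 0 with hg
  have hcount : ∀ j, Measurable fun q : Fin k → Plane => (cellCount h q j : ℝ≥0∞) ^ m := fun j =>
    (measurable_from_top.comp (measurable_cellCount h j)).pow_const m
  have hind : ∀ j, Measurable ((connectedSet Rmax k).indicator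
      fun q => (cellCount h q j : ℝ≥0∞) ^ m) := fun j =>
    (hcount j).indicator (measurableSet_connectedSet Rmax k)
  have hgm : Measurable g := by
    refine Finset.measurable_sum _ fun j _ => Measurable.ite ?_ ?_ measurable_const
    · exact measurableSet_cell_eq h measurable_fst ((measurable_pi_apply j).comp measurable_snd)
    · exact ((hind j).comp measurable_snd).const_mul _
  calc _ ≤ ∫⁻ p, g (MeasurableEquiv.piFinSuccAbove (fun _ : Fin (k + 1) => Plane) i p)
          ∂(Measure.pi fun _ => ν) := by
        refine lintegral_mono fun p => ?_
        change _ ≤ g (p i, i.removeNth p)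
        split_ifs with hp
        · have h1 := cellCount_pow_succ_le hp.2 m
          have hmem : i.removeNth p ∈ connectedSet Rmax k := hp.1
          simp only [hg, Set.indicator_of_mem hmem]
          exact_mod_cast h1
        · exact zero_le
    _ = ∫⁻ z, g z ∂(ν.prod (Measure.pi fun _ => ν)) := hmp.lintegral_comp hgm
    _ = ∫⁻ q, ∫⁻ x, g (x, q) ∂ν ∂(Measure.pi fun _ => ν) := lintegral_prod_symm' _ hgm
    _ ≤ ∫⁻ q, 2 ^ (m + 1) * α * (connectedSet Rmax k).indicator
          (fun q => ∑ j, (cellCount h q j : ℝ≥0∞) ^ m) q ∂(Measure.pi fun _ => ν) := by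
        refine lintegral_mono fun q => ?_
        have hcell : ∀ j, MeasurableSet {x | cell h x = cell h (q j)} := fun j =>
          measurableSet_cell_eq h measurable_id measurable_const
        simp only [hg]
        rw [lintegral_finsetSum _ fun j _ =>
          Measurable.ite (hcell j) measurable_const measurable_const]
        have hj : ∀ j, ∫⁻ x, (if cell h x = cell h (q j) then
            2 ^ (m + 1) * (connectedSet Rmax k).indicator
              (fun q => (cellCount h q j : ℝ≥0∞) ^ m) q else 0) ∂ν
            ≤ 2 ^ (m + 1) * α * (connectedSet Rmax k).indicator
              (fun q => (cellCount h q j : ℝ≥0∞) ^ m) q := by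
          intro j
          have : (fun x => if cell h x = cell h (q j) then
            2 ^ (m + 1) * (connectedSet Rmax k).indicator
              (fun q => (cellCount h q j : ℝ≥0∞) ^ m) q else 0)
            = {x | cell h x = cell h (q j)}.indicator fun _ =>
              2 ^ (m + 1) * (connectedSet Rmax k).indicator
              (fun q => (cellCount h q j : ℝ≥0∞) ^ m) q := by
            ext x
            simp [Set.indicator_apply]
          rw [this, lintegral_indicator_const (hcell j), mul_right_comm]
          gcongr
          exact hα (q j)
        refine (Finset.sum_le_sum fun j _ => hj j).trans (le_of_eq ?_)
        rw [← Finset.mul_sum]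
        congr 1
        by_cases hq : q ∈ connectedSet Rmax k <;> simp [hq]
    _ = _ := by
        rw [lintegral_const_mul, lintegral_indicator (measurableSet_connectedSet Rmax k)]
        exact (Finset.measurable_sum _ fun j _ => hcount j).indicator
          (measurableSet_connectedSet Rmax k)

/-- Moments of the crowding of a connected network, reduced to lower moments for a network with
one agent less. -/
theorem lintegral_sum_cellCount_pow_le (hR : 0 < Rmax) {α : ℝ≥0∞}
    (hα : ∀ x, ν {y | cell (Rmax / 2) y = cell (Rmax / 2) x} ≤ α) (k m : ℕ) :
    ∫⁻ p in connectedSet Rmax (k + 1), ∑ i, (cellCount (Rmax / 2) p i : ℝ≥0∞) ^ (m + 1)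
        ∂(Measure.pi fun _ => ν)
      ≤ 100 ^ (m + 1) * (k + 1) * (Measure.pi fun _ => ν) (connectedSet Rmax (k + 1))
        + 2 * ((k + 1) * (2 ^ (m + 1) * α * ∫⁻ q in connectedSet Rmax k,
          ∑ j, (cellCount (Rmax / 2) q j : ℝ≥0∞) ^ m ∂(Measure.pi fun _ => ν))) := by
  classical
  have hred : ∀ i : Fin (k + 1), MeasurableSet {p : Fin (k + 1) → Plane | Redundant Rmax p i} := by
    intro i
    have h1 : Measurable fun p : Fin (k + 1) → Plane => i.removeNth p :=
      measurable_pi_iff.2 fun j => measurable_pi_apply _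
    have h2 : {p : Fin (k + 1) → Plane | Redundant Rmax p i}
        = (fun p => i.removeNth p) ⁻¹' connectedSet Rmax k ∩
          ⋃ j, {p | cell (Rmax / 2) (i.removeNth p j) = cell (Rmax / 2) (p i)} := by
      ext p
      simp [Redundant, connectedSet]
    rw [h2]
    exact (h1 (measurableSet_connectedSet Rmax k)).inter (MeasurableSet.iUnion fun j =>
      measurableSet_cell_eq _ (measurable_pi_apply _) (measurable_pi_apply _))
  have hterm : ∀ i : Fin (k + 1), Measurable fun p : Fin (k + 1) → Plane =>
      if Redundant Rmax p i then (cellCount (Rmax / 2) p i : ℝ≥0∞) ^ (m + 1) else 0 := fun i =>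
    Measurable.ite (hred i)
      ((measurable_from_top.comp (measurable_cellCount _ i)).pow_const _) measurable_const
  calc _ ≤ ∫⁻ p in connectedSet Rmax (k + 1), (100 ^ (m + 1) * (k + 1)
          + 2 * ∑ i, if Redundant Rmax p i then
            (cellCount (Rmax / 2) p i : ℝ≥0∞) ^ (m + 1) else 0) ∂(Measure.pi fun _ => ν) := by
        refine setLIntegral_mono (measurable_const.add
          ((Finset.measurable_sum _ fun i _ => hterm i).const_mul _)) fun p hp => ?_
        have h1 := sum_cellCount_pow_le hR hp (m + 1)
        exact_mod_cast h1
    _ = 100 ^ (m + 1) * (k + 1) * (Measure.pi fun _ => ν) (connectedSet Rmax (k + 1))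
          + 2 * ∑ i, ∫⁻ p in connectedSet Rmax (k + 1), (if Redundant Rmax p i then
            (cellCount (Rmax / 2) p i : ℝ≥0∞) ^ (m + 1) else 0) ∂(Measure.pi fun _ => ν) := by
        rw [lintegral_add_left measurable_const, setLIntegral_const,
          lintegral_const_mul _ (Finset.measurable_sum _ fun i _ => hterm i),
          lintegral_finsetSum _ fun i _ => hterm i]
    _ ≤ _ := by
        gcongr
        refine (Finset.sum_le_sum fun i _ => (setLIntegral_le_lintegral _ _).trans
          (lintegral_redundant_le hα k m i)).trans (le_of_eq ?_)
        simp

end Resampling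

/-! ### Connected networks with small coverage -/

section Domination

/-- A connected graph on at least two vertices has a dominating set of at most half of the
vertices. -/
theorem exists_dominating {k : ℕ} (hk : 2 ≤ k) {G : SimpleGraph (Fin k)} (hG : G.Connected) :
    ∃ I : Finset (Fin k), 2 * I.card ≤ k ∧ ∀ j ∉ I, ∃ i ∈ I, G.Adj j i := by
  classical
  -- In a two-coloured spanning tree every vertex has a neighbour of the other colour, so both
  -- classes dominate; the smaller one is taken.
  obtain ⟨T, hTG, hT⟩ := hG.exists_isTree_le
  obtain ⟨C⟩ := hT.colorable_two
  have : Nontrivial (Fin k) := Fin.nontrivial_iff_two_le.2 hk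
  have hdom : ∀ c : Fin 2, ∀ j, C j ≠ c → ∃ i, C i = c ∧ G.Adj j i := by
    intro c j hj
    obtain ⟨i, hi⟩ := hT.connected.preconnected.exists_adj_of_nontrivial j
    have h := C.valid hi
    exact ⟨i, by omega, hTG hi⟩
  have hcard := Finset.card_filter_add_card_filter_not (s := Finset.univ) fun j => C j = 0
  rw [Finset.card_univ, Fintype.card_fin] at hcard
  rcases le_total (Finset.univ.filter fun j => C j = 0).card
    (Finset.univ.filter fun j => ¬ C j = 0).card with h | h
  · refine ⟨Finset.univ.filter fun j => C j = 0, by omega, fun j hj => ?_⟩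
    obtain ⟨i, hi, hadj⟩ := hdom 0 j (by simpa using hj)
    exact ⟨i, by simpa using hi, hadj⟩
  · refine ⟨Finset.univ.filter fun j => ¬ C j = 0, by omega, fun j hj => ?_⟩
    have hj' : C j = 0 := by simpa using hj
    obtain ⟨i, hi, hadj⟩ := hdom 1 j (by rw [hj']; decide)
    exact ⟨i, by simp [hi], hadj⟩

open scoped ENNReal

variable {Rmax : ℝ} {ν : Measure Plane} [IsProbabilityMeasure ν]

/-- The agents outside `I` all fall into the coverage of the agents in `I` with small
probability, if that coverage is small. -/
theorem measure_forall_mem_coverage_le {k : ℕ} (I : Finset (Fin k)) (ε : ℝ≥0∞) :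
    (Measure.pi fun _ => ν) {p : Fin k → Plane |
      (∀ j : {j // j ∉ I}, p j ∈ coverage Rmax fun i : {i // i ∈ I} => p i) ∧
        ν (coverage Rmax fun i : {i // i ∈ I} => p i) ≤ ε} ≤ ε ^ (k - I.card) := by
  have hmp := measurePreserving_piEquivPiSubtypeProd (fun _ : Fin k => ν) fun i => i ∈ I
  set B : Set (({i // i ∈ I} → Plane) × ({j // j ∉ I} → Plane)) :=
    {z | (∀ j, z.2 j ∈ coverage Rmax z.1) ∧ ν (coverage Rmax z.1) ≤ ε} with hB
  have hBm : MeasurableSet B := by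
    have h1 : ∀ j : {j // j ∉ I}, MeasurableSet
        {z : ({i // i ∈ I} → Plane) × ({j // j ∉ I} → Plane) | z.2 j ∈ coverage Rmax z.1} :=
      fun j => by
        have hm : Measurable fun z : ({i // i ∈ I} → Plane) × ({j // j ∉ I} → Plane) =>
            (z.2 j, z.1) := by fun_prop
        exact hm (measurableSet_coverage_prod Rmax)
    have h2 : MeasurableSet {z : ({i // i ∈ I} → Plane) × ({j // j ∉ I} → Plane) |
        ν (coverage Rmax z.1) ≤ ε} :=
      measurableSet_le ((measurable_measure_coverage Rmax ν).comp measurable_fst)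
        measurable_const
    exact (measurableSet_setOfPred.2 (Measurable.forall fun j => measurableSet_setOfPred.1 (h1 j))).inter h2
  have hpre : {p : Fin k → Plane |
      (∀ j : {j // j ∉ I}, p j ∈ coverage Rmax fun i : {i // i ∈ I} => p i) ∧
        ν (coverage Rmax fun i : {i // i ∈ I} => p i) ≤ ε}
      = (MeasurableEquiv.piEquivPiSubtypeProd (fun _ : Fin k => Plane) fun i => i ∈ I) ⁻¹' B := rfl
  rw [hpre, hmp.measure_preimage hBm.nullMeasurableSet, Measure.prod_apply hBm]
  -- Given the agents in `I`, the others are independent and each is covered with probability at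
  -- most `ε`.
  have hsec : ∀ q : {i // i ∈ I} → Plane,
      (Measure.pi fun _ : {j // j ∉ I} => ν) (Prod.mk q ⁻¹' B) ≤ ε ^ (k - I.card) := by
    intro q
    by_cases hq : ν (coverage Rmax q) ≤ ε
    · have hsub : Prod.mk q ⁻¹' B ⊆ Set.univ.pi fun _ => coverage Rmax q :=
        fun r hr j _ => hr.1 j
      refine (measure_mono hsub).trans ?_
      rw [Measure.pi_pi, Finset.prod_const, Finset.card_univ, Fintype.card_subtype_compl,
        Fintype.card_fin, Fintype.card_coe]
      gcongr
    · have hempty : Prod.mk q ⁻¹' B = ∅ := Set.eq_empty_of_forall_notMem fun r hr => hq hr.2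
      rw [hempty, measure_empty]
      exact zero_le
  refine (lintegral_mono hsec).trans (le_of_eq ?_)
  rw [lintegral_const, measure_univ, mul_one]

/-- Connected networks with small coverage are exponentially unlikely. -/
theorem measure_connected_small_coverage_le {k : ℕ} (hk : 2 ≤ k) {s : ℝ≥0∞} (hs : s ≤ 1) :
    (Measure.pi fun _ => ν) (connectedSet Rmax k ∩ {p | ν (coverage Rmax p) ≤ s ^ 2})
      ≤ (2 * s) ^ k := by
  classical
  set A : Finset (Fin k) → Set (Fin k → Plane) := fun I => {p |
      (∀ j : {j // j ∉ I}, p j ∈ coverage Rmax fun i : {i // i ∈ I} => p i) ∧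
        ν (coverage Rmax fun i : {i // i ∈ I} => p i) ≤ s ^ 2} with hA
  have hsub : connectedSet Rmax k ∩ {p | ν (coverage Rmax p) ≤ s ^ 2}
      ⊆ ⋃ I ∈ Finset.univ.filter fun I : Finset (Fin k) => 2 * I.card ≤ k, A I := by
    rintro p ⟨hp, hcov⟩
    obtain ⟨I, hI, hdom⟩ := exists_dominating hk hp
    refine Set.mem_biUnion (x := I) (by simpa using hI) ⟨fun j => ?_, le_trans ?_ hcov⟩
    · obtain ⟨i, hi, hadj⟩ := hdom j j.2
      exact ⟨⟨i, hi⟩, hadj.2⟩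
    · exact measure_mono fun x hx => ⟨hx.choose, hx.choose_spec⟩
  refine (measure_mono hsub).trans ((measure_biUnion_finset_le _ _).trans ?_)
  -- `2(k - |I|) ≥ k` turns the bound into `s^k`; the at most `2^k` choices of `I` account for the
  -- remaining factor.
  have hterm : ∀ I ∈ Finset.univ.filter fun I : Finset (Fin k) => 2 * I.card ≤ k,
      (Measure.pi fun _ => ν) (A I) ≤ s ^ k := by
    intro I hI
    refine (measure_forall_mem_coverage_le I (s ^ 2)).trans ?_
    rw [← pow_mul]
    have h := (Finset.mem_filter.1 hI).2
    exact pow_le_pow_right_of_le_one' hs (by omega)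
  refine (Finset.sum_le_sum hterm).trans ?_
  rw [Finset.sum_const, nsmul_eq_mul, mul_pow]
  gcongr
  have h := Finset.card_filter_le (Finset.univ : Finset (Finset (Fin k))) fun I => 2 * I.card ≤ k
  rw [Finset.card_univ, Fintype.card_finset, Fintype.card_fin] at h
  exact_mod_cast h

/-- If connected networks with small coverage are rare among connected networks, then adding an
agent costs at most a constant factor in the probability of connectivity. -/
theorem measure_connectedSet_succ_ge {k : ℕ} (hk : 2 ≤ k) {s : ℝ≥0∞} (hs : s ≤ 1)
    (hsmall : 2 * (2 * s) ^ k ≤ (Measure.pi fun _ => ν) (connectedSet Rmax k)) :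
    s ^ 2 * (Measure.pi fun _ => ν) (connectedSet Rmax k)
      ≤ 2 * (Measure.pi fun _ => ν) (connectedSet Rmax (k + 1)) := by
  set μ := (Measure.pi fun _ : Fin k => ν) with hμ
  set B : Set (Fin k → Plane) := {p | ν (coverage Rmax p) ≤ s ^ 2} with hB
  have hBm : MeasurableSet B :=
    measurableSet_le (measurable_measure_coverage Rmax ν) measurable_const
  have h1 := measure_connected_small_coverage_le (Rmax := Rmax) (ν := ν) hk hs
  have h2 : s ^ 2 * μ (connectedSet Rmax k \ B)
      ≤ (Measure.pi fun _ => ν) (connectedSet Rmax (k + 1)) := by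
    refine le_trans ?_ (lintegral_coverage_le k)
    calc s ^ 2 * μ (connectedSet Rmax k \ B)
        = ∫⁻ _ in connectedSet Rmax k \ B, s ^ 2 ∂μ := (setLIntegral_const _ _).symm
      _ ≤ ∫⁻ q in connectedSet Rmax k \ B, ν (coverage Rmax q) ∂μ :=
          setLIntegral_mono (measurable_measure_coverage Rmax ν) fun q hq => (not_le.1 hq.2).le
      _ ≤ _ := lintegral_mono_set Set.sdiff_subset
  have h3 := measure_inter_add_sdiff (μ := μ) (connectedSet Rmax k) hBm
  have h4 : μ (connectedSet Rmax k) ≤ 2 * μ (connectedSet Rmax k \ B) := by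
    have h5 : 2 * μ (connectedSet Rmax k ∩ B) ≤ μ (connectedSet Rmax k) :=
      le_trans (by gcongr) hsmall
    have hfin : μ (connectedSet Rmax k ∩ B) ≠ ∞ := measure_ne_top _ _
    have hfin' : μ (connectedSet Rmax k \ B) ≠ ∞ := measure_ne_top _ _
    rw [← h3] at h5 ⊢
    rw [two_mul] at h5 ⊢
    exact add_le_add_left ((ENNReal.add_le_add_iff_left hfin).1 h5) _
  calc s ^ 2 * μ (connectedSet Rmax k) ≤ s ^ 2 * (2 * μ (connectedSet Rmax k \ B)) := by gcongr
    _ = 2 * (s ^ 2 * μ (connectedSet Rmax k \ B)) := by ring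
    _ ≤ _ := by gcongr

end Domination

/-! ### Probability of visiting every set of a disjoint family -/

section LowerBound

open scoped ENNReal Nat

/-- A lower bound for the number of surjections onto a finite type. -/
theorem factorial_mul_pow_le_card_surjective {J : Type*} [Fintype J] {k : ℕ}
    (hk : Fintype.card J ≤ k) :
    (Fintype.card J)! * Fintype.card J ^ (k - Fintype.card J)
      ≤ Nat.card {g : Fin k → J // Function.Surjective g} := by
  classical
  induction k, hk using Nat.le_induction with
  | base =>
    rw [Nat.sub_self, pow_zero, mul_one]
    have h := Fintype.card_equiv (Fintype.equivFin J)
    rw [← h, ← Nat.card_eq_fintype_card]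
    refine Nat.card_le_card_of_injective (fun e : J ≃ Fin (Fintype.card J) =>
      (⟨e.symm, e.symm.surjective⟩ : {g : Fin (Fintype.card J) → J // Function.Surjective g})) ?_
    intro e e' hee
    have h1 : (e.symm : Fin (Fintype.card J) → J) = e'.symm := congrArg Subtype.val hee
    have h2 : e.symm = e'.symm := DFunLike.coe_injective h1
    simpa using congrArg Equiv.symm h2
  | succ k hk ih =>
    -- The value at an additional index is free, so each one multiplies the count by at least `|J|`,
    -- starting from the bijections.
    have h : Nat.card (J × {g : Fin k → J // Function.Surjective g})
        ≤ Nat.card {g : Fin (k + 1) → J // Function.Surjective g} := by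
      refine Nat.card_le_card_of_injective (fun z => ⟨Fin.cons z.1 z.2.1, fun y => ?_⟩) ?_
      · obtain ⟨i, hi⟩ := z.2.2 y
        exact ⟨i.succ, by rw [Fin.cons_succ, hi]⟩
      · rintro ⟨j, g⟩ ⟨j', g'⟩ hgg
        have h1 : (Fin.cons j g.1 : Fin (k + 1) → J) = Fin.cons j' g'.1 :=
          congrArg Subtype.val hgg
        obtain ⟨h2, h3⟩ := Fin.cons_inj.1 h1
        exact Prod.ext h2 (Subtype.ext h3)
    rw [Nat.card_prod, Nat.card_eq_fintype_card] at h
    refine le_trans ?_ h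
    rw [Nat.succ_sub hk, pow_succ]
    calc _ = Fintype.card J * ((Fintype.card J)! * Fintype.card J ^ (k - Fintype.card J)) := by ring
      _ ≤ _ := Nat.mul_le_mul_left _ ih

/-- From `M! ≥ (M/e)^M`: visiting all `M` sets costs only a constant factor per point. -/
theorem pow_div_exp_le_factorial_mul_pow {M k : ℕ} (hk : M ≤ k) :
    ((M : ℝ) / Real.exp 1) ^ k ≤ (M ! : ℝ) * (M : ℝ) ^ (k - M) := by
  have h1 := Real.pow_div_factorial_le_exp (M : ℝ) (Nat.cast_nonneg M) M
  rw [div_le_iff₀ (by positivity)] at h1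
  have h2 : Real.exp M ≤ Real.exp 1 ^ k := by
    rw [← Real.exp_nat_mul, mul_one]
    exact Real.exp_le_exp.2 (by exact_mod_cast hk)
  rw [div_pow, div_le_iff₀ (by positivity)]
  calc (M : ℝ) ^ k = (M : ℝ) ^ M * (M : ℝ) ^ (k - M) := by rw [← pow_add, Nat.add_sub_cancel' hk]
    _ ≤ (Real.exp M * M !) * (M : ℝ) ^ (k - M) := by gcongr
    _ ≤ (Real.exp 1 ^ k * M !) * (M : ℝ) ^ (k - M) := by gcongr
    _ = _ := by ring

/-- If the points visit all the sets of a disjoint family with a given property, the probability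
of this property is bounded below. -/
theorem measure_pi_ge_of_surjective {J : Type*} [Fintype J] {ν : Measure Plane}
    [IsProbabilityMeasure ν] {B : J → Set Plane} (hB : ∀ j, MeasurableSet (B j))
    (hdisj : Pairwise fun i j => Disjoint (B i) (B j)) {β : ℝ} (hβ : 0 ≤ β)
    (hνB : ∀ j, ENNReal.ofReal β ≤ ν (B j)) {k : ℕ} (hk : Fintype.card J ≤ k)
    {S : Set (Fin k → Plane)}
    (hS : ∀ g : Fin k → J, Function.Surjective g → ∀ p : Fin k → Plane,
      (∀ i, p i ∈ B (g i)) → p ∈ S) :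
    ENNReal.ofReal ((Fintype.card J * β / Real.exp 1) ^ k) ≤ (Measure.pi fun _ => ν) S := by
  classical
  have hsub : ⋃ g : {g : Fin k → J // Function.Surjective g}, Set.univ.pi (fun i => B (g.1 i))
      ⊆ S := by
    refine Set.iUnion_subset fun g p hp => hS g.1 g.2 p fun i => hp i trivial
  refine le_trans ?_ (measure_mono hsub)
  rw [measure_iUnion, tsum_fintype]
  · have hterm : ∀ g : {g : Fin k → J // Function.Surjective g}, ENNReal.ofReal (β ^ k)
        ≤ (Measure.pi fun _ => ν) (Set.univ.pi (fun i => B (g.1 i))) := by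
      intro g
      rw [Measure.pi_pi, ENNReal.ofReal_pow hβ]
      refine le_trans (le_of_eq ?_) (Finset.prod_le_prod' fun i _ => hνB (g.1 i))
      simp
    refine le_trans ?_ (Finset.sum_le_sum fun g _ => hterm g)
    rw [Finset.sum_const, nsmul_eq_mul, Finset.card_univ,
      ← Nat.card_eq_fintype_card (α := {g : Fin k → J // Function.Surjective g}),
      ← ENNReal.ofReal_natCast, ← ENNReal.ofReal_mul (Nat.cast_nonneg _)]
    refine ENNReal.ofReal_le_ofReal ?_
    rw [mul_div_right_comm, mul_pow]
    gcongr
    refine (pow_div_exp_le_factorial_mul_pow hk).trans ?_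
    exact_mod_cast factorial_mul_pow_le_card_surjective hk
  · intro g g' hgg
    obtain ⟨i, hi⟩ := Function.ne_iff.1 fun h => hgg (Subtype.ext h)
    exact Set.disjoint_univ_pi.2 ⟨i, hdisj hi⟩
  · exact fun g => MeasurableSet.univ_pi fun i => hB _

end LowerBound

/-! ### Connectivity through a grid of disks -/

section Grid

/-- The points of a square grid of mesh `d`. -/
noncomputable def gridPoint (x : Plane) (d : ℝ) (a b : ℕ) : Plane := x + !₂[d * a, d * b]

theorem dist_le_abs_add_abs (x y : Plane) : dist x y ≤ |x 0 - y 0| + |x 1 - y 1| := by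
  rw [EuclideanSpace.dist_eq, Real.sqrt_le_left (by positivity), Fin.sum_univ_two,
    Real.dist_eq, Real.dist_eq]
  nlinarith [abs_nonneg (x 0 - y 0), abs_nonneg (x 1 - y 1)]

theorem dist_gridPoint_le (x : Plane) {d : ℝ} (hd : 0 ≤ d) (a b a' b' : ℕ) :
    dist (gridPoint x d a b) (gridPoint x d a' b')
      ≤ d * (|(a : ℝ) - a'| + |(b : ℝ) - b'|) := by
  refine (dist_le_abs_add_abs _ _).trans (le_of_eq ?_)
  simp only [gridPoint, PiLp.add_apply, add_sub_add_left_eq_sub]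
  simp [← mul_sub, abs_mul, abs_of_nonneg hd, mul_add]

theorem le_dist_gridPoint (x : Plane) {d : ℝ} (hd : 0 ≤ d) {a b a' b' : ℕ}
    (h : (a, b) ≠ (a', b')) : d ≤ dist (gridPoint x d a b) (gridPoint x d a' b') := by
  have hone : ∀ u v : ℕ, u ≠ v → (1 : ℝ) ≤ |(u : ℝ) - v| := by
    intro u v huv
    have h1 : (1 : ℤ) ≤ |(u : ℤ) - v| := Int.one_le_abs (by omega)
    exact_mod_cast h1
  by_cases ha : a = a'
  · have hb : b ≠ b' := fun hb => h (by rw [ha, hb])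
    refine le_trans ?_ (abs_apply_sub_le_dist _ _ 1)
    simp only [gridPoint, PiLp.add_apply, add_sub_add_left_eq_sub]
    simpa [← mul_sub, abs_mul, abs_of_nonneg hd] using le_mul_of_one_le_right hd (hone b b' hb)
  · refine le_trans ?_ (abs_apply_sub_le_dist _ _ 0)
    simp only [gridPoint, PiLp.add_apply, add_sub_add_left_eq_sub]
    simpa [← mul_sub, abs_mul, abs_of_nonneg hd] using le_mul_of_one_le_right hd (hone a a' ha)

theorem dist_gridPoint_self_le (x : Plane) {d : ℝ} (hd : 0 ≤ d) (a b : ℕ) :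
    dist (gridPoint x d a b) x ≤ d * (a + b) := by
  have h := dist_gridPoint_le x hd a b 0 0
  have h0 : gridPoint x d 0 0 = x := by
    ext i
    fin_cases i <;> simp [gridPoint]
  simpa [h0] using h

/-- Agents that visit small disks around all the points of a grid form a connected network. -/
theorem connected_of_grid {Rmax : ℝ} (hR : 0 < Rmax) (x : Plane) {m k : ℕ} (hm : 0 < m)
    {g : Fin k → Fin m × Fin m} (hg : Function.Surjective g) {p : Fin k → Plane}
    (hp : ∀ i, p i ∈ Metric.ball (gridPoint x (Rmax / 2) (g i).1 (g i).2) (Rmax / 8)) :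
    (commGraph Rmax p).Connected := by
  have hstep : ∀ i j, |(((g i).1 : ℕ) : ℝ) - ((g j).1 : ℕ)| +
      |(((g i).2 : ℕ) : ℝ) - ((g j).2 : ℕ)| ≤ 1 → (commGraph Rmax p).Reachable i j := by
    intro i j hij
    refine reachable_of_dist_le ?_
    -- Agents at adjacent grid points are within `Rmax/2 + 2 · Rmax/8 < Rmax`.
    have h1 := dist_gridPoint_le x (half_pos hR).le (g i).1 (g i).2 (g j).1 (g j).2
    have h2 := Metric.mem_ball.1 (hp i)
    have h3 := Metric.mem_ball'.1 (hp j)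
    have h4 := dist_triangle4 (p i) (gridPoint x (Rmax / 2) (g i).1 (g i).2)
      (gridPoint x (Rmax / 2) (g j).1 (g j).2) (p j)
    have h5 := mul_le_mul_of_nonneg_left hij (half_pos hR).le
    linarith
  obtain ⟨i₀, hi₀⟩ := hg (⟨0, hm⟩, ⟨0, hm⟩)
  -- Induction on the sum of the coordinates: one step down or left leads towards the corner agent
  -- `i₀`.
  have hall : ∀ s : ℕ, ∀ i, ((g i).1 : ℕ) + ((g i).2 : ℕ) = s →
      (commGraph Rmax p).Reachable i i₀ := by
    intro s
    induction s with
    | zero =>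
      intro i hi
      refine hstep i i₀ ?_
      have h1 : ((g i).1 : ℕ) = 0 := by omega
      have h2 : ((g i).2 : ℕ) = 0 := by omega
      rw [h1, h2, hi₀]
      simp
    | succ s ih =>
      intro i hi
      rcases Nat.eq_zero_or_pos ((g i).1 : ℕ) with h1 | h1
      · obtain ⟨j, hj⟩ := hg ((g i).1, ⟨((g i).2 : ℕ) - 1, by omega⟩)
        refine (hstep i j ?_).trans (ih j ?_)
        · rw [hj]
          have h2 : (((g i).2 : ℕ) : ℝ) = ((((g i).2 : ℕ) - 1 : ℕ) : ℝ) + 1 := by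
            exact_mod_cast (show ((g i).2 : ℕ) = ((g i).2 : ℕ) - 1 + 1 by omega)
          simp only
          rw [h2]
          simp
        · rw [hj]
          simp only
          omega
      · obtain ⟨j, hj⟩ := hg (⟨((g i).1 : ℕ) - 1, by omega⟩, (g i).2)
        refine (hstep i j ?_).trans (ih j ?_)
        · rw [hj]
          have h2 : (((g i).1 : ℕ) : ℝ) = ((((g i).1 : ℕ) - 1 : ℕ) : ℝ) + 1 := by
            exact_mod_cast (show ((g i).1 : ℕ) = ((g i).1 : ℕ) - 1 + 1 by omega)
          simp only
          rw [h2]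
          simp
        · rw [hj]
          simp only
          omega
  have : Nonempty (Fin k) := ⟨i₀⟩
  exact ⟨fun i j => (hall _ i rfl).trans (hall _ j rfl).symm⟩

/-- A lower bound for the probability of connectivity in a region that contains a disk. -/
theorem measure_connectedSet_ge {Rmax : ℝ} (hR : 0 < Rmax) {S : Set Plane}
    (hS : MeasurableSet S) {a : ℝ} (ha : 0 < a) (hvol : volume S = ENNReal.ofReal a)
    {x : Plane} {ρ : ℝ} (hx : Metric.ball x ρ ⊆ S) {m k : ℕ} (hm : 0 < m) (hmρ : Rmax * m ≤ ρ)
    (hmk : m * m ≤ k) :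
    ENNReal.ofReal ((((m * m : ℕ) : ℝ) *
        ((volume (Metric.ball (0 : Plane) (Rmax / 8))).toReal / a) / Real.exp 1) ^ k)
      ≤ binomialLaw S k (connectedSet Rmax k) := by
  have hS0 : volume S ≠ 0 := by
    rw [hvol]
    simpa using ha
  have hStop : volume S ≠ ⊤ := by
    rw [hvol]
    exact ENNReal.ofReal_ne_top
  have : IsProbabilityMeasure (cond volume S) := cond_isProbabilityMeasure_of_finite hS0 hStop
  have hcard : Fintype.card (Fin m × Fin m) = m * m := by simp
  have h := measure_pi_ge_of_surjective (ν := cond volume S) (k := k)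
    (B := fun j : Fin m × Fin m =>
      Metric.ball (gridPoint x (Rmax / 2) (j.1 : ℕ) (j.2 : ℕ)) (Rmax / 8))
    (fun j => measurableSet_ball) ?_
    (β := (volume (Metric.ball (0 : Plane) (Rmax / 8))).toReal / a) (by positivity) ?_
    (by rw [hcard]; exact hmk) (S := connectedSet Rmax k)
    (fun g hg p hp => connected_of_grid hR x hm hg hp)
  · rwa [hcard] at h
  · intro i j hij
    refine Metric.ball_disjoint_ball ?_
    have hne : ((i.1 : ℕ), (i.2 : ℕ)) ≠ ((j.1 : ℕ), (j.2 : ℕ)) := fun h =>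
      hij (Prod.ext (Fin.ext (congrArg Prod.fst h)) (Fin.ext (congrArg Prod.snd h)))
    have := le_dist_gridPoint x (half_pos hR).le hne
    linarith
  · intro j
    have hsub : Metric.ball (gridPoint x (Rmax / 2) (j.1 : ℕ) (j.2 : ℕ)) (Rmax / 8) ⊆ S := by
      refine (Metric.ball_subset_ball' ?_).trans hx
      have h1 := dist_gridPoint_self_le x (half_pos hR).le (j.1 : ℕ) (j.2 : ℕ)
      have h2 : ((j.1 : ℕ) : ℝ) + 1 ≤ m := by exact_mod_cast j.1.2
      have h3 : ((j.2 : ℕ) : ℝ) + 1 ≤ m := by exact_mod_cast j.2.2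
      have h4 : Rmax / 2 * (((j.1 : ℕ) : ℝ) + ((j.2 : ℕ) : ℝ)) ≤ Rmax / 2 * (2 * m - 2) := by
        gcongr
        linarith
      linarith
    rw [cond_apply hS, Set.inter_eq_self_of_subset_right hsub,
      Measure.addHaar_ball_center volume (gridPoint x (Rmax / 2) (j.1 : ℕ) (j.2 : ℕ)), hvol,
      ENNReal.ofReal_div_of_pos ha, ENNReal.ofReal_toReal measure_ball_lt_top.ne,
      ENNReal.div_eq_inv_mul]

end Grid

/-! ### Moment bound under conditioning and divergence of the mean -/

section Conclusion

open scoped ENNReal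

/-- A region of intensity `lam` puts mass of order `1 / n` on every cell. -/
theorem cond_cell_le {Rmax : ℝ} (hR : 0 < Rmax) {S : Set Plane} (hS : MeasurableSet S) {a : ℝ}
    (ha : 0 < a) (hvol : volume S = ENNReal.ofReal a) (x : Plane) :
    cond volume S {y | cell (Rmax / 2) y = cell (Rmax / 2) x}
      ≤ ENNReal.ofReal ((volume (Metric.closedBall (0 : Plane) Rmax)).toReal / a) := by
  have hsub : {y | cell (Rmax / 2) y = cell (Rmax / 2) x} ⊆ Metric.closedBall x Rmax :=
    fun y hy => dist_le_of_cell_half_eq hR hy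
  rw [cond_apply hS, hvol, ENNReal.ofReal_div_of_pos ha,
    ENNReal.ofReal_toReal measure_closedBall_lt_top.ne, ENNReal.div_eq_inv_mul,
    ← Measure.addHaar_closedBall_center volume x]
  gcongr
  exact Set.inter_subset_right.trans hsub

/-- Moment bound for the crowding, given that the probability of connectivity does not drop by
more than a constant factor when an agent is added. -/
theorem lintegral_sum_cellCount_sq_le {Rmax : ℝ} (hR : 0 < Rmax) {ν : Measure Plane}
    [IsProbabilityMeasure ν] {α w T : ℝ≥0∞}
    (hα : ∀ x, ν {y | cell (Rmax / 2) y = cell (Rmax / 2) x} ≤ α) {k : ℕ}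
    (hw : ((k + 2 : ℕ) : ℝ≥0∞) * α ≤ w)
    (h1 : (Measure.pi fun _ => ν) (connectedSet Rmax k)
      ≤ T * (Measure.pi fun _ => ν) (connectedSet Rmax (k + 1)))
    (h2 : (Measure.pi fun _ => ν) (connectedSet Rmax (k + 1))
      ≤ T * (Measure.pi fun _ => ν) (connectedSet Rmax (k + 2))) :
    ∫⁻ p in connectedSet Rmax (k + 2), ∑ i, (cellCount (Rmax / 2) p i : ℝ≥0∞) ^ 2
        ∂(Measure.pi fun _ => ν)
      ≤ (10000 + 8 * w * (100 * T + 4 * w * T ^ 2)) * (k + 2 : ℕ) *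
        (Measure.pi fun _ => ν) (connectedSet Rmax (k + 2)) := by
  set a := (Measure.pi fun _ => ν) (connectedSet Rmax k)
  set b := (Measure.pi fun _ => ν) (connectedSet Rmax (k + 1))
  set c := (Measure.pi fun _ => ν) (connectedSet Rmax (k + 2))
  set n : ℝ≥0∞ := ((k + 2 : ℕ) : ℝ≥0∞) with hn
  have hkn : (k : ℝ≥0∞) ≤ n := by rw [hn]; exact_mod_cast (by omega : k ≤ k + 2)
  have hkn1 : (k : ℝ≥0∞) + 1 ≤ n := by rw [hn]; exact_mod_cast (by omega : k + 1 ≤ k + 2)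
  have hkn2 : ((k + 1 : ℕ) : ℝ≥0∞) + 1 = n := by rw [hn]; push_cast; ring
  -- Two deletions lead from the second moment to the first and then to the zeroth, which is the
  -- number of agents; `T` pays for each change of the conditioning event.
  have hm1 := lintegral_sum_cellCount_pow_le hR hα (k + 1) 1
  have hm0 := lintegral_sum_cellCount_pow_le hR hα k 0
  have hzero : ∫⁻ q in connectedSet Rmax k, ∑ j, (cellCount (Rmax / 2) q j : ℝ≥0∞) ^ 0
      ∂(Measure.pi fun _ => ν) = k * a := by
    simp [a]
  rw [hzero] at hm0
  simp only [zero_add] at hm0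
  have hfirst : ∫⁻ p in connectedSet Rmax (k + 1), ∑ i, (cellCount (Rmax / 2) p i : ℝ≥0∞) ^ 1
        ∂(Measure.pi fun _ => ν) ≤ (100 * T + 4 * w * T ^ 2) * n * c := by
    refine hm0.trans ?_
    calc 100 ^ 1 * ((k : ℝ≥0∞) + 1) * b + 2 * ((k + 1) * (2 ^ 1 * α * (k * a)))
        ≤ 100 ^ 1 * n * b + 2 * (n * (2 ^ 1 * α * (n * a))) := by gcongr
      _ = 100 * n * b + 4 * (n * α) * (n * a) := by ring
      _ ≤ 100 * n * (T * c) + 4 * w * (n * (T * (T * c))) := by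
          gcongr
          exact h1.trans (by gcongr)
      _ = _ := by ring
  refine hm1.trans ?_
  rw [hkn2]
  calc 100 ^ (1 + 1) * n * c + 2 * (n * (2 ^ (1 + 1) * α *
        ∫⁻ p in connectedSet Rmax (k + 1), ∑ i, (cellCount (Rmax / 2) p i : ℝ≥0∞) ^ 1
        ∂(Measure.pi fun _ => ν)))
      ≤ 100 ^ (1 + 1) * n * c + 2 * (n * (2 ^ (1 + 1) * α *
        ((100 * T + 4 * w * T ^ 2) * n * c))) := by gcongr
    _ = 10000 * n * c + 8 * (n * α) * ((100 * T + 4 * w * T ^ 2) * n * c) := by ring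
    _ ≤ 10000 * n * c + 8 * w * ((100 * T + 4 * w * T ^ 2) * n * c) := by gcongr
    _ = _ := by ring

/-- In an extended network, the probability of connectivity decays at most exponentially. -/
theorem exists_pow_le_measure_connectedSet {lam Rmax : ℝ} (hlam : 0 < lam) (hR : 0 < Rmax)
    {region : ℕ → Set Plane} (hregion : IsExtended lam region) :
    ∃ c : ℝ, 0 < c ∧ c ≤ 1 ∧ ∀ᶠ n : ℕ in atTop, ∀ k : ℕ, n ≤ 2 * k →
      ENNReal.ofReal (c ^ k) ≤ binomialLaw (region n) k (connectedSet Rmax k) := by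
  obtain ⟨δ, hδ, hdisk⟩ := hregion.disk
  set V : ℝ := (volume (Metric.ball (0 : Plane) (Rmax / 8))).toReal with hV
  have hVpos : 0 < V := ENNReal.toReal_pos
    (Metric.measure_ball_pos volume _ (by positivity)).ne' measure_ball_lt_top.ne
  -- The bound `1` keeps `m² ≤ n/4 ≤ k`; the bound `δ / Rmax` keeps the grid inside the disk.
  set θ : ℝ := min 1 (δ / Rmax) with hθ
  have hθ0 : 0 < θ := lt_min one_pos (by positivity)
  have hθ1 : θ ≤ 1 := min_le_left _ _
  have hθR : Rmax * θ ≤ δ := by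
    rw [mul_comm, ← le_div_iff₀ hR]
    exact min_le_right _ _
  set c₀ : ℝ := θ ^ 2 * lam * V / (16 * Real.exp 1) with hc₀
  have hc₀pos : 0 < c₀ := by positivity
  refine ⟨min c₀ 1, lt_min hc₀pos one_pos, min_le_right _ _, ?_⟩
  have hlarge : ∀ᶠ n : ℕ in atTop, 1 ≤ θ * √(n : ℝ) / 2 := by
    have h : Tendsto (fun n : ℕ => θ / 2 * √(n : ℝ)) atTop atTop :=
      (Real.tendsto_sqrt_atTop.comp tendsto_natCast_atTop_atTop).const_mul_atTop (by positivity)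
    filter_upwards [h.eventually_ge_atTop 1] with n hn
    linarith
  filter_upwards [hdisk, hlarge] with n ⟨x, hx⟩ hn k hk
  have hn0 : (0 : ℝ) < n := by
    rcases Nat.eq_zero_or_pos n with h | h
    · rw [h] at hn
      norm_num at hn
    · exact_mod_cast h
  set y : ℝ := θ * √(n : ℝ) / 2 with hy
  have hy2 : y ^ 2 = θ ^ 2 * n / 4 := by
    rw [hy, div_pow, mul_pow, Real.sq_sqrt hn0.le]
    norm_num
  set m : ℕ := ⌊y⌋₊ with hm
  have hm_le : (m : ℝ) ≤ y := Nat.floor_le (by positivity)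
  have hm_lt : y < m + 1 := Nat.lt_floor_add_one y
  have hm1 : 1 ≤ m := Nat.le_floor (by exact_mod_cast hn)
  have hm1' : (1 : ℝ) ≤ m := by exact_mod_cast hm1
  have hmk : m * m ≤ k := by
    have h1 : (m : ℝ) * m ≤ y ^ 2 := by nlinarith
    have h2 : θ ^ 2 * n / 4 ≤ n / 4 := by
      have : θ ^ 2 ≤ 1 := pow_le_one₀ hθ0.le hθ1
      nlinarith
    have h3 : (n : ℝ) ≤ 2 * k := by exact_mod_cast hk
    have h4 : (m : ℝ) * m ≤ k := by
      have : (0 : ℝ) ≤ k := Nat.cast_nonneg k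
      linarith
    exact_mod_cast h4
  have hmρ : Rmax * m ≤ δ * √(n : ℝ) := by
    have h1 : Rmax * m ≤ Rmax * y := by gcongr
    have h2 : Rmax * θ * √(n : ℝ) ≤ δ * √(n : ℝ) := by gcongr
    have h3 : 0 ≤ Rmax * θ * √(n : ℝ) := by positivity
    have h4 : Rmax * y = Rmax * θ * √(n : ℝ) / 2 := by
      rw [hy]
      ring
    linarith
  have h := measure_connectedSet_ge hR (hregion.measurableSet n) (a := n / lam) (by positivity)
    (hregion.area n) hx hm1 hmρ hmk
  refine le_trans (ENNReal.ofReal_le_ofReal ?_) h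
  have hle : min c₀ 1 ≤ ((m * m : ℕ) : ℝ) * (V / (n / lam)) / Real.exp 1 := by
    refine (min_le_left _ _).trans ?_
    -- From `y < m + 1 ≤ 2m` one gets `m² ≥ y²/4`, whence the `16` in `c₀`.
    have h1 : θ ^ 2 * n / 16 ≤ ((m * m : ℕ) : ℝ) := by
      push_cast
      nlinarith
    calc c₀ = θ ^ 2 * n / 16 * (V / (n / lam)) / Real.exp 1 := by
          rw [hc₀]
          field_simp
      _ ≤ _ := by gcongr
  exact pow_le_pow_left₀ (le_min hc₀pos.le zero_le_one) hle k

/-- In a connected extended network, the mean crowding of the cells is bounded. -/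
theorem exists_lintegral_cellCount_le {lam Rmax : ℝ} (hlam : 0 < lam) (hR : 0 < Rmax)
    {region : ℕ → Set Plane} (hregion : IsExtended lam region) :
    ∃ Q : ℝ, 0 < Q ∧ ∀ᶠ n : ℕ in atTop, IsProbabilityMeasure (binomialLaw (region n) n) ∧
      binomialLaw (region n) n (connectedSet Rmax n) ≠ 0 ∧
      ∫⁻ p in connectedSet Rmax n, ∑ i, (cellCount (Rmax / 2) p i : ℝ≥0∞) ^ 2
        ∂(binomialLaw (region n) n)
      ≤ ENNReal.ofReal (Q * n) * binomialLaw (region n) n (connectedSet Rmax n) := by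
  obtain ⟨c, hc0, hc1, hconn⟩ := exists_pow_le_measure_connectedSet hlam hR hregion
  -- Then `2(2s)^l = 2(c/2)^l ≤ c^l` for `l ≥ 1`, so small coverage takes at most half of the
  -- connected mass.
  set s : ℝ := c / 4 with hs
  have hs0 : 0 < s := by positivity
  set W : ℝ := (volume (Metric.closedBall (0 : Plane) Rmax)).toReal with hW
  have hW0 : 0 ≤ W := ENNReal.toReal_nonneg
  set Q : ℝ := 10000 + 8 * (W * lam) * (100 * (2 / s ^ 2) + 4 * (W * lam) * (2 / s ^ 2) ^ 2)
    with hQ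
  have hQ0 : 0 < Q := by positivity
  refine ⟨Q, hQ0, ?_⟩
  -- The region stays that of `n` agents while two are deleted; `n ≥ 4` ensures `n ≤ 2(n - 2)`, as
  -- `hconn` requires.
  filter_upwards [hconn, eventually_ge_atTop 4] with n hn hn4
  obtain ⟨k, rfl⟩ : ∃ k, n = k + 2 := ⟨n - 2, by omega⟩
  have ha : 0 < ((k + 2 : ℕ) : ℝ) / lam := by positivity
  have hvol := hregion.area (k + 2)
  have hS0 : volume (region (k + 2)) ≠ 0 := by
    rw [hvol]
    simpa using ha
  have hStop : volume (region (k + 2)) ≠ ⊤ := by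
    rw [hvol]
    exact ENNReal.ofReal_ne_top
  have hprob : IsProbabilityMeasure (cond volume (region (k + 2))) :=
    cond_isProbabilityMeasure_of_finite hS0 hStop
  have hprob' : IsProbabilityMeasure (binomialLaw (region (k + 2)) (k + 2)) := by
    unfold binomialLaw
    infer_instance
  have hratio : ∀ l, k ≤ l → (Measure.pi fun _ => cond volume (region (k + 2)))
        (connectedSet Rmax l) ≤ ENNReal.ofReal (2 / s ^ 2) *
      (Measure.pi fun _ => cond volume (region (k + 2))) (connectedSet Rmax (l + 1)) := by
    intro l hl
    have hpow : 2 * (2 * ENNReal.ofReal s) ^ l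
        ≤ (Measure.pi fun _ => cond volume (region (k + 2))) (connectedSet Rmax l) := by
      refine le_trans ?_ (hn l (by omega))
      rw [show (2 : ℝ≥0∞) = ENNReal.ofReal 2 by simp, ← ENNReal.ofReal_mul (by norm_num),
        ← ENNReal.ofReal_pow (by positivity), ← ENNReal.ofReal_mul (by norm_num)]
      refine ENNReal.ofReal_le_ofReal ?_
      have h1 : 2 * s = c * (1 / 2) := by
        rw [hs]
        ring
      have h2 : (1 / 2 : ℝ) ^ l ≤ (1 / 2) ^ 1 :=
        pow_le_pow_of_le_one (by norm_num) (by norm_num) (by omega)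
      rw [h1, mul_pow]
      have h3 : 0 < c ^ l := by positivity
      nlinarith
    have h := measure_connectedSet_succ_ge (Rmax := Rmax) (by omega : 2 ≤ l)
      (s := ENNReal.ofReal s) (by rw [ENNReal.ofReal_le_one]; linarith) hpow
    have hs2 : ENNReal.ofReal s ^ 2 = ENNReal.ofReal (s ^ 2) := (ENNReal.ofReal_pow hs0.le 2).symm
    rw [ENNReal.ofReal_div_of_pos (by positivity), ← hs2, ENNReal.ofReal_ofNat,
      ← ENNReal.mul_div_right_comm, ENNReal.le_div_iff_mul_le (by simp [hs0]) (by simp), mul_comm]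
    exact h
  refine ⟨hprob', ?_, ?_⟩
  · have h := hn (k + 2) (by omega)
    intro h0
    rw [h0, nonpos_iff_eq_zero, ENNReal.ofReal_eq_zero] at h
    exact absurd h (not_le.2 (by positivity))
  · have hw : ((k + 2 : ℕ) : ℝ≥0∞) * ENNReal.ofReal (W / (((k + 2 : ℕ) : ℝ) / lam))
        ≤ ENNReal.ofReal (W * lam) := by
      rw [← ENNReal.ofReal_natCast, ← ENNReal.ofReal_mul (by positivity)]
      refine ENNReal.ofReal_le_ofReal (le_of_eq ?_)
      field_simp
    have h := lintegral_sum_cellCount_sq_le hR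
      (cond_cell_le hR (hregion.measurableSet (k + 2)) ha hvol) hw (hratio k le_rfl)
      (hratio (k + 1) (by omega))
    refine h.trans (le_of_eq ?_)
    have hcast : ∀ u v : ℝ, 0 ≤ u → 0 ≤ v →
        ENNReal.ofReal (10000 + 8 * u * (100 * v + 4 * u * v ^ 2)) = 10000 + 8 * ENNReal.ofReal u *
          (100 * ENNReal.ofReal v + 4 * ENNReal.ofReal u * ENNReal.ofReal v ^ 2) := by
      intro u v hu hv
      rw [ENNReal.ofReal_add (by norm_num) (by positivity), ENNReal.ofReal_mul (by positivity),
        ENNReal.ofReal_mul (by norm_num), ENNReal.ofReal_add (by positivity) (by positivity),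
        ENNReal.ofReal_mul (by norm_num), ENNReal.ofReal_mul (by positivity),
        ENNReal.ofReal_mul (by norm_num), ENNReal.ofReal_pow hv]
      simp
    have hQe := hcast (W * lam) (2 / s ^ 2) (by positivity) (by positivity)
    rw [← hQ] at hQe
    rw [ENNReal.ofReal_mul hQ0.le, hQe, ENNReal.ofReal_natCast]
    rfl

/-- The relative synchronization error bound is a bounded measurable function. -/
theorem integrable_rseb (rounds : ℕ) (σ Rmax : ℝ) {n : ℕ} (μ : Measure (Fin n → Plane))
    [IsFiniteMeasure μ] : Integrable (fun p => rseb rounds σ Rmax p) μ := by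
  classical
  -- The bound depends on the positions only through the graph, so it takes finitely many values.
  set F : SimpleGraph (Fin n) → ℝ := fun G =>
    (n : ℝ)⁻¹ * (pinv ((2 * (rounds : ℝ) / σ ^ 2) • G.lapMatrix ℝ)).trace
  have hrseb : ∀ p : Fin n → Plane, rseb rounds σ Rmax p = F (commGraph Rmax p) := by
    intro p
    rw [rseb, fim_eq]
  have hmeas : Measurable fun p : Fin n → Plane => rseb rounds σ Rmax p := by
    intro t _
    have : (fun p : Fin n → Plane => rseb rounds σ Rmax p) ⁻¹' t
        = {p | commGraph Rmax p ∈ F ⁻¹' t} := by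
      ext p
      simp [hrseb]
    rw [this]
    exact measurableSet_commGraph_mem Rmax _
  obtain ⟨C, hC⟩ := (Set.finite_range fun G => ‖F G‖).bddAbove
  refine Integrable.of_bound hmeas.aestronglyMeasurable C (Eventually.of_forall fun p => ?_)
  rw [hrseb]
  exact hC ⟨_, rfl⟩

/-- A function that is at least `L` with probability at least one half has expectation at least
`L / 2`; here the good event is that the crowding is at most twice its mean. -/
theorem integral_rseb_ge {rounds : ℕ} {σ Rmax L q : ℝ} {n : ℕ} (hL : 0 ≤ L) (hq : 0 < q)
    {μ : Measure (Fin n → Plane)} [IsProbabilityMeasure μ]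
    (hconn : ∀ᵐ p ∂μ, p ∈ connectedSet Rmax n)
    (hmean : ∫⁻ p, ∑ i, (cellCount (Rmax / 2) p i : ℝ≥0∞) ^ 2 ∂μ ≤ ENNReal.ofReal q)
    (hgood : ∀ p ∈ connectedSet Rmax n, ∑ i, (cellCount (Rmax / 2) p i : ℝ) ^ 2 ≤ 2 * q →
      L ≤ rseb rounds σ Rmax p) :
    L / 2 ≤ ∫ p, rseb rounds σ Rmax p ∂μ := by
  have hmarkov : μ {p | ENNReal.ofReal (2 * q)
      ≤ ∑ i, (cellCount (Rmax / 2) p i : ℝ≥0∞) ^ 2} ≤ ENNReal.ofReal (1 / 2) := by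
    have hmeas : Measurable fun p : Fin n → Plane =>
        ∑ i, (cellCount (Rmax / 2) p i : ℝ≥0∞) ^ 2 :=
      Finset.measurable_sum _ fun i _ =>
        (measurable_from_top.comp (measurable_cellCount _ i)).pow_const _
    refine (meas_ge_le_lintegral_div hmeas.aemeasurable (by simpa using hq)
      ENNReal.ofReal_ne_top).trans ?_
    refine (ENNReal.div_le_div_right hmean _).trans (le_of_eq ?_)
    rw [← ENNReal.ofReal_div_of_pos (by positivity)]
    congr 1
    field_simp
  have hcover : (1 : ℝ≥0∞) ≤ μ {p | L ≤ rseb rounds σ Rmax p} + ENNReal.ofReal (1 / 2) := by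
    have hae : (Set.univ : Set (Fin n → Plane)) ≤ᵐ[μ] ({p | L ≤ rseb rounds σ Rmax p} ∪
        {p | ENNReal.ofReal (2 * q) ≤ ∑ i, (cellCount (Rmax / 2) p i : ℝ≥0∞) ^ 2} : Set _) := by
      filter_upwards [hconn] with p hp _
      by_cases h : ∑ i, (cellCount (Rmax / 2) p i : ℝ) ^ 2 ≤ 2 * q
      · exact Or.inl (hgood p hp h)
      · right
        have h1 : ENNReal.ofReal (2 * q)
            ≤ ENNReal.ofReal (∑ i, (cellCount (Rmax / 2) p i : ℝ) ^ 2) :=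
          ENNReal.ofReal_le_ofReal (not_le.1 h).le
        refine h1.trans (le_of_eq ?_)
        rw [ENNReal.ofReal_sum_of_nonneg fun i _ => by positivity]
        refine Finset.sum_congr rfl fun i _ => ?_
        rw [ENNReal.ofReal_pow (Nat.cast_nonneg _), ENNReal.ofReal_natCast]
    rw [← measure_univ (μ := μ)]
    refine (measure_mono_ae hae).trans ((measure_union_le _ _).trans ?_)
    gcongr
  have hhalf : 1 / 2 ≤ μ.real {p | L ≤ rseb rounds σ Rmax p} := by
    have h1 := ENNReal.toReal_mono (by simp) hcover
    rw [ENNReal.toReal_add (measure_ne_top _ _) ENNReal.ofReal_ne_top,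
      ENNReal.toReal_ofReal (by norm_num), ENNReal.toReal_one] at h1
    rw [Measure.real]
    linarith
  have h := mul_meas_ge_le_integral_of_nonneg (μ := μ)
    (Eventually.of_forall fun p => rseb_nonneg rounds σ Rmax p)
    (integrable_rseb rounds σ Rmax μ) L
  refine le_trans ?_ h
  rw [div_eq_mul_one_div]
  gcongr

end Conclusion

end NetSync

theorem proposition4 (lam Rmax σ : ℝ) (rounds : ℕ)
    (hlam : 0 < lam) (hR : 0 < Rmax) (hσ : 0 < σ) (hrounds : 0 < rounds)
    (region : ℕ → Set NetSync.Plane) (hregion : NetSync.IsExtended lam region) :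
    Tendsto (fun n : ℕ =>
      ∫ p, NetSync.rseb rounds σ Rmax p ∂(NetSync.connectedLaw Rmax (region n) n))
      atTop atTop := by
  obtain ⟨Q, hQ, hbound⟩ := NetSync.exists_lintegral_cellCount_le hlam hR hregion
  -- `2 * Q` replaces `Q` because Markov's inequality admits crowding up to twice its mean bound.
  set A : ℝ := 64 * (3136 * (2 * rounds / σ ^ 2) * (2 * Q)) with hA
  have hA0 : 0 < A := by positivity
  have hlog : Tendsto (fun n : ℕ => Real.log n) atTop atTop :=
    Real.tendsto_log_atTop.comp tendsto_natCast_atTop_atTop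
  have hlim : Tendsto (fun n : ℕ => (Real.log n - 12) / A / 2) atTop atTop :=
    ((tendsto_atTop_add_const_right _ (-12) hlog).atTop_div_const hA0).atTop_div_const two_pos
  have hsqrt : ∀ᶠ n : ℕ in atTop, 36 * (2 * Q) ≤ n.sqrt := by
    obtain ⟨M, hM⟩ := exists_nat_ge (36 * (2 * Q))
    filter_upwards [eventually_ge_atTop (M * M)] with n hn
    exact hM.trans (by exact_mod_cast Nat.le_sqrt.2 hn)
  refine tendsto_atTop_mono' _ ?_ hlim
  filter_upwards [hbound, hsqrt, hlog.eventually_ge_atTop 12, eventually_gt_atTop 0] with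
    n ⟨hprob, hne, hmean⟩ hn hlog12 hn0
  have hn0' : (0 : ℝ) < n := by exact_mod_cast hn0
  have hconnm := NetSync.measurableSet_connectedSet Rmax n
  have hlaw : NetSync.connectedLaw Rmax (region n) n
      = cond (NetSync.binomialLaw (region n) n) (NetSync.connectedSet Rmax n) := rfl
  have : IsProbabilityMeasure (cond (NetSync.binomialLaw (region n) n)
      (NetSync.connectedSet Rmax n)) := cond_isProbabilityMeasure hne
  rw [hlaw]
  refine NetSync.integral_rseb_ge (q := Q * n) (by have := sub_nonneg.2 hlog12; positivity)
    (by positivity) (ae_cond_mem hconnm) ?_ fun p hp hcount => ?_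
  · rw [ProbabilityTheory.cond, lintegral_smul_measure, smul_eq_mul, ← ENNReal.div_eq_inv_mul]
    exact ENNReal.div_le_of_le_mul hmean
  · exact NetSync.rseb_ge_log hrounds hσ hR (by positivity) hn hp
      (hcount.trans_eq (mul_assoc _ _ _).symm)
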